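/- Let $a,b,c,d\in\mathbb R$ with $ad-bc=1$, $b\neq 0$ and $a/b$ irrational, and let $Q(x,y)=(ay+bx)(cy+dx)$. Let $$\frac ab=[a_0,a_1,a_2,\dots]=a_0-\cfrac{1}{a_1-\cfrac{1}{a_2-\cdots}}$$ be the minus continued fraction expansion of $a/b$ given by the nearest integer (Hurwitz) algorithm: $\xi_0=a/b$, $a_j$ is the integer nearest to $\xi_j$, and $\xi_{j+1}=1/(a_j-\xi_j)$. (So $|a_j|\ge 2$ for all $j\ge 1$; we put $\log 0=0$ in case $a_0=0$, the term $j=0$ being irrelevant to all the limits below.) Put $\lambda=\frac{3-\sqrt5}{2}$, $\mu=\frac{23-3\sqrt5}{22}$, and let $d_{\mathbb H}$ be the hyperbolic distance in the upper half plane. Let $\chi_j=\log 2-\frac12 d_{\mathbb H}\!\left(\mu+i\sqrt{1-\mu^2},\ \frac12(3+i\sqrt3)\right)$ if $|a_j|=2$ and $\chi_j=\frac12\log(3\sqrt5)$ otherwise. Define, in $(-\infty,+\infty]$, $$\alpha^+=\limsup_{n\to\infty}\frac1n\sum_{j=0}^{n-1}\log|a_j|,\qquad \alpha^-=\liminf_{n\to\infty}\frac1n\sum_{j=0}^{n-1}\log|a_j|,\qquad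 \omega=\liminf_{n\to\infty}\frac1n\sum_{j=0}^{n-1}\bigl(\log|a_j|-\chi_j\bigr).$$ For $\delta>0$ let $$e^-(\delta)=\liminf_{n\to\infty}\frac1n\#\{0\le i\le n-1: |a_i|>2\delta^{-2}+\tfrac12+\lambda\},\qquad f^+(\delta)=\limsup_{n\to\infty}\frac1n\#\{0\le i\le n-1: |a_i|>2\delta^{-2}-\tfrac32+\lambda\}.$$ Let $c_0=\frac12\left(\log(3\sqrt5)+\log\left(\frac34+\sqrt{\tfrac12}\right)\right)$ and $\eta=\frac{\log(9/5)}{4\log 3}$. Let $0<\delta<\sqrt{2/\pi}$ and $\kappa>0$, and for $\rho\in\mathbb R$ let $$G(\rho)=\left\{(x,y)\in\mathbb Z^2:\ \gcd(x,y)=1,\ 0<|Q(x,y)|<\tfrac12\delta^2,\ cy+dx>\kappa,\ \sqrt{x^2+y^2}\le\rho\right\}.$$ Let $\epsilon>0$. Then: (i) if $\alpha^+<\infty$, there exists $\rho_0$ such that for all $\rho\ge\rho_0$ $$\#G(\rho)\ \ge\ (1-\epsilon)\,\frac{e^-(\delta)}{\alpha^++c_0}\,\log\rho;$$ (ii) for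 every real $M$ with $0<M\le\omega$ there exists $\rho_0$ such that for all $\rho\ge\rho_0$ $$\#G(\rho)\ \le\ (1+\epsilon)\,\frac{f^+(\delta)+\epsilon}{M}\,\log\rho.$$ In particular, the conclusion of (ii) holds for every real $M$ with $0<M\le\eta\,\alpha^-$ (for every $M>0$ if $\alpha^-=+\infty$). -/

import Mathlib

open Filter Topology

namespace HurwitzForm

noncomputable section

/-- Complete quotients of the minus continued fraction of `ξ` with respect to the nearest
integer (Hurwitz) algorithm: `ξ₀ = ξ`, `ξⱼ₊₁ = 1 / (aⱼ - ξⱼ)` with `aⱼ` the integer nearest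
to `ξⱼ`, so that `ξ = a₀ - 1 / (a₁ - 1 / (a₂ - ⋯))`. -/
def quotient (ξ : ℝ) : ℕ → ℝ
  | 0 => ξ
  | j + 1 => 1 / ((round (quotient ξ j) : ℝ) - quotient ξ j)

/-- The partial quotients `aⱼ` of the minus continued fraction expansion
`ξ = [a₀, a₁, …]` with respect to the nearest integer (Hurwitz) algorithm. -/
def digit (ξ : ℝ) (j : ℕ) : ℤ := round (quotient ξ j)

/-- `α_n = ∑_{j<n} log |a_j|`. -/
def alphaSum (ξ : ℝ) (n : ℕ) : ℝ := ∑ j ∈ Finset.range n, Real.log |(digit ξ j : ℝ)|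

/-- `α⁺ = limsup α_n / n`, possibly `+∞`. -/
def alphaPlus (ξ : ℝ) : EReal := limsup (fun n : ℕ => ((alphaSum ξ n / n : ℝ) : EReal)) atTop

/-- `α⁻ = liminf α_n / n`, possibly `+∞`. -/
def alphaMinus (ξ : ℝ) : EReal := liminf (fun n : ℕ => ((alphaSum ξ n / n : ℝ) : EReal)) atTop

/-- `λ = (3 - √5) / 2`. -/
def lam : ℝ := (3 - √5) / 2

/-- `μ = (23 - 3√5) / 22`. -/
def mu : ℝ := (23 - 3 * √5) / 22

theorem mu_sq_lt_one : mu ^ 2 < 1 := by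
  have h1 : (2 : ℝ) ≤ √5 := Real.le_sqrt_of_sq_le (by norm_num)
  have h2 : √5 ≤ (3 : ℝ) := Real.sqrt_le_iff.mpr (by norm_num)
  unfold mu
  nlinarith

/-- The point `μ + i √(1 - μ²)` of the hyperbolic upper half plane. -/
def pointA : UpperHalfPlane :=
  ⟨⟨mu, √(1 - mu ^ 2)⟩, Real.sqrt_pos.mpr (sub_pos.mpr mu_sq_lt_one)⟩

/-- The point `(3 + i √3) / 2` of the hyperbolic upper half plane. -/
def pointB : UpperHalfPlane :=
  ⟨⟨3 / 2, √3 / 2⟩, half_pos (Real.sqrt_pos.mpr three_pos)⟩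

/-- `χ = log 2 - d(μ + i √(1 - μ²), (3 + i √3) / 2) / 2`, with `d` the hyperbolic distance. -/
def chi : ℝ := Real.log 2 - dist pointA pointB / 2

/-- `χ_j`, which is `χ` if `|a_j| = 2` and `(1/2) log (3√5)` otherwise. -/
def chiSeq (ξ : ℝ) (j : ℕ) : ℝ :=
  if |digit ξ j| = 2 then chi else Real.log (3 * √5) / 2

/-- `ω_n = ∑_{j<n} (log |a_j| - χ_j)`. -/
def omegaSum (ξ : ℝ) (n : ℕ) : ℝ :=
  ∑ j ∈ Finset.range n, (Real.log |(digit ξ j : ℝ)| - chiSeq ξ j)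

/-- `ω = liminf ω_n / n`, possibly `+∞`. -/
def omega (ξ : ℝ) : EReal := liminf (fun n : ℕ => ((omegaSum ξ n / n : ℝ) : EReal)) atTop

/-- `e(δ, n)`, the number of `i < n` with `|a_i| > 2δ⁻² + 1/2 + λ`. -/
def eCount (ξ δ : ℝ) (n : ℕ) : ℕ :=
  {i ∈ Finset.range n | 2 / δ ^ 2 + 1 / 2 + lam < |(digit ξ i : ℝ)|}.card

/-- `f(δ, n)`, the number of `i < n` with `|a_i| > 2δ⁻² - 3/2 + λ`. -/
def fCount (ξ δ : ℝ) (n : ℕ) : ℕ :=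
  {i ∈ Finset.range n | 2 / δ ^ 2 - 3 / 2 + lam < |(digit ξ i : ℝ)|}.card

/-- `e⁻(δ)`, the liminf of the sequence `e(δ, n) / n`, which takes values in `[0, 1]`. -/
def eMinus (ξ δ : ℝ) : ℝ := liminf (fun n : ℕ => (eCount ξ δ n : ℝ) / n) atTop

/-- `f⁺(δ)`, the limsup of the sequence `f(δ, n) / n`, which takes values in `[0, 1]`. -/
def fPlus (ξ δ : ℝ) : ℝ := limsup (fun n : ℕ => (fCount ξ δ n : ℝ) / n) atTop

/-- `c₀ = (log (3√5) + log (3/4 + √(1/2))) / 2`. -/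
def c0 : ℝ := (Real.log (3 * √5) + Real.log (3 / 4 + √(1 / 2))) / 2

/-- `η = log (9/5) / (4 log 3)`. -/
def eta : ℝ := Real.log (9 / 5) / (4 * Real.log 3)

/-- For `Q(x, y) = (a y + b x)(c y + d x)`, the set `G(ρ)` of primitive integral pairs `(x, y)`
with `0 < |Q(x, y)| < δ² / 2`, `c y + d x > κ` and Euclidean norm at most `ρ`. -/
def G (a b c d δ κ ρ : ℝ) : Set (ℤ × ℤ) :=
  {p | Int.gcd p.1 p.2 = 1 ∧
    0 < |(a * p.2 + b * p.1) * (c * p.2 + d * p.1)| ∧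
    |(a * p.2 + b * p.1) * (c * p.2 + d * p.1)| < δ ^ 2 / 2 ∧
    κ < c * p.2 + d * p.1 ∧
    ‖!₂[(p.1 : ℝ), (p.2 : ℝ)]‖ ≤ ρ}

/-- The set `G(ρ)` is finite, so that its `Set.ncard` is its true number of elements. -/
theorem G_finite (a b c d δ κ ρ : ℝ) : (G a b c d δ κ ρ).Finite := by
  refine ((Set.finite_Icc (-⌈ρ⌉) ⌈ρ⌉).prod (Set.finite_Icc (-⌈ρ⌉) ⌈ρ⌉)).subset ?_
  rintro ⟨x, y⟩ ⟨-, -, -, -, h⟩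
  have hx : |(x : ℝ)| ≤ ρ := (PiLp.norm_apply_le !₂[(x : ℝ), (y : ℝ)] 0).trans h
  have hy : |(y : ℝ)| ≤ ρ := (PiLp.norm_apply_le !₂[(x : ℝ), (y : ℝ)] 1).trans h
  have key : ∀ z : ℤ, |(z : ℝ)| ≤ ρ → z ∈ Set.Icc (-⌈ρ⌉) ⌈ρ⌉ := by
    intro z hz
    have : |(z : ℝ)| ≤ ⌈ρ⌉ := hz.trans (Int.le_ceil ρ)
    have h' : |z| ≤ ⌈ρ⌉ := by exact_mod_cast this
    exact abs_le.mp h'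
  exact ⟨key x hx, key y hy⟩

end

end HurwitzForm

namespace HurwitzForm

noncomputable section

/-! Put `ξ = a / b` and `L = y ξ + x`. Since the determinant is `1`, the form equals `-(y L - d b
L²)`, and `b (c y + d x) = d b L - y`. The condition `c y + d x > κ` keeps `L` bounded and makes it
small once `|y|` is large, so there the form is `-y L` up to a small error. As `δ² / 2 < 0.38 <
lam`, the pair `(-x, y)` then satisfies `|y L| < lam`, and a Legendre theorem for the nearest
integer algorithm (`eq_convergent`) identifies it, up to sign, with a convergent. The sign is fixed
by `c y + d x > κ`.

At a convergent with denominator `q` and error `q ξ - p`, the product `q |q ξ - p|` is the inverse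
of `|ξₘ - s|`, with `ξₘ` a complete quotient and `s` a ratio of consecutive denominators
(`abs_den_mul_err`). Because `ξₘ` is within `1/2` of `aₘ`, because `|s| ≤ 1 - lam`, and because `|s|
> lam` only when `s` and `ξₘ` have opposite signs, this inverse lies between `|aₘ| - 1/2 - lam` and
`|aₘ| + 3/2 - lam`. These are the two digit thresholds. The quadratic term has relative size
`O(q⁻²)` and must not disturb them: below, digits are integers and leave a fixed gap
(`abs_lt_of_lt_abs_digit`); above, `q² (1 - lam - |s|)` eventually exceeds any constant
(`sq_den_mul_one_sub_lam_sub`, used in `lt_abs_digit_of_abs_lt`). So, up to a bounded number, the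
points of norm at most `ρ` are governed by the large digits whose denominators are at most a
constant times `ρ`.

It remains to see how many denominators lie below `ρ`. Each step multiplies the denominator by `aₙ -
s`. Crude estimates of this factor bound `log |den|` above by the `alphaSum` plus `n log 2`, and
below, up to a constant, by `omegaSum` and by `eta * alphaSum` (`log_den_le`, `omegaSum_le`,
`eta_mul_alphaSum_le`). The limits then give the counts. -/

/-- Denominators of the convergents, shifted by one so that `den ξ 0 = 0`. -/
def den (ξ : ℝ) : ℕ → ℤ
  | 0 => 0
  | 1 => 1
  | n + 2 => digit ξ (n + 1) * den ξ (n + 1) - den ξ n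

/-- Numerators of the convergents, shifted by one so that `num ξ 0 = 1`. -/
def num (ξ : ℝ) : ℕ → ℤ
  | 0 => 1
  | 1 => digit ξ 0
  | n + 2 => digit ξ (n + 1) * num ξ (n + 1) - num ξ n

/-- The approximation error `q ξ - p` of the convergent `p / q`. -/
def err (ξ : ℝ) (n : ℕ) : ℝ := den ξ n * ξ - num ξ n

/-- The ratio of consecutive denominators. -/
def ratio (ξ : ℝ) (n : ℕ) : ℝ := den ξ n / den ξ (n + 1)

/-! ### The constant `lam`, complete quotients and digits -/

theorem lam_sq : lam ^ 2 = 3 * lam - 1 := by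
  have := Real.sq_sqrt (show (0 : ℝ) ≤ 5 by norm_num)
  unfold lam; nlinarith

theorem lam_gt : 0.38 < lam := by
  have : √5 < 2.24 := (Real.sqrt_lt' (by norm_num)).2 (by norm_num)
  unfold lam; linarith

theorem lam_lt : lam < 0.382 := by
  have : 2.236 < √5 := (Real.lt_sqrt (by norm_num)).2 (by norm_num)
  unfold lam; linarith

theorem num_mul_den (ξ : ℝ) (n : ℕ) :
    num ξ n * den ξ (n + 1) - num ξ (n + 1) * den ξ n = 1 := by
  induction n with
  | zero => simp [num, den]
  | succ n ih => simp only [num, den]; linarith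

theorem irrational_quotient {ξ : ℝ} (h : Irrational ξ) (n : ℕ) : Irrational (quotient ξ n) := by
  induction n with
  | zero => exact h
  | succ n ih =>
    simp only [quotient, one_div]
    exact (ih.intCast_sub _).inv

theorem abs_digit_sub_quotient {ξ : ℝ} (h : Irrational ξ) (n : ℕ) :
    |(digit ξ n : ℝ) - quotient ξ n| < 1 / 2 := by
  have h1 := abs_sub_round (quotient ξ n)
  rw [abs_sub_comm] at h1
  refine lt_of_le_of_ne h1 fun h2 => ?_
  have h3 := (irrational_quotient h n).intCast_sub (digit ξ n)
  rcases abs_choice ((digit ξ n : ℝ) - quotient ξ n) with h4 | h4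
  · refine h3 ⟨1 / 2, ?_⟩
    rw [h4] at h2; push_cast; linarith
  · refine h3 ⟨-(1 / 2), ?_⟩
    rw [h4] at h2; push_cast; linarith

theorem digit_sub_quotient_ne {ξ : ℝ} (h : Irrational ξ) (n : ℕ) :
    (digit ξ n : ℝ) - quotient ξ n ≠ 0 :=
  ((irrational_quotient h n).intCast_sub (digit ξ n)).ne_zero

theorem quotient_succ_mul {ξ : ℝ} (h : Irrational ξ) (n : ℕ) :
    quotient ξ (n + 1) * ((digit ξ n : ℝ) - quotient ξ n) = 1 := by
  have := digit_sub_quotient_ne h n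
  rw [quotient]; exact one_div_mul_cancel this

theorem two_lt_abs_quotient {ξ : ℝ} (h : Irrational ξ) (n : ℕ) : 2 < |quotient ξ (n + 1)| := by
  have h1 := abs_digit_sub_quotient h n
  have h2 := congrArg abs (quotient_succ_mul h n)
  rw [abs_mul, abs_one] at h2
  by_contra! h3
  nlinarith [abs_nonneg (quotient ξ (n + 1)), abs_nonneg ((digit ξ n : ℝ) - quotient ξ n)]

theorem digit_cases {ξ : ℝ} (h : Irrational ξ) (n : ℕ) :
    (2 < quotient ξ (n + 1) ∧ 2 ≤ digit ξ (n + 1)) ∨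
      (quotient ξ (n + 1) < -2 ∧ digit ξ (n + 1) ≤ -2) := by
  have h1 := abs_lt.1 (abs_digit_sub_quotient h (n + 1))
  rcases lt_abs.1 (two_lt_abs_quotient h n) with h2 | h2
  · left
    refine ⟨h2, ?_⟩
    have : ((1 : ℤ) : ℝ) < digit ξ (n + 1) := by push_cast; linarith
    have := Int.cast_lt.1 this; omega
  · right
    refine ⟨by linarith, ?_⟩
    have : (digit ξ (n + 1) : ℝ) < ((-1 : ℤ) : ℝ) := by push_cast; linarith
    have := Int.cast_lt.1 this; omega

theorem two_le_abs_digit {ξ : ℝ} (h : Irrational ξ) (n : ℕ) : 2 ≤ |digit ξ (n + 1)| := by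
  rcases digit_cases h n with h1 | h1
  · exact h1.2.trans (le_abs_self _)
  · have := neg_le_abs (digit ξ (n + 1)); omega

/-- A digit of absolute value two is followed by a sign change. -/
theorem quotient_neg_of_digit_eq_two {ξ : ℝ} (h : Irrational ξ) (n : ℕ)
    (h2 : |digit ξ (n + 1)| = 2) :
    (digit ξ (n + 1) : ℝ) * quotient ξ (n + 2) < 0 := by
  have hm := quotient_succ_mul h (n + 1)
  rcases digit_cases h n with h1 | h1
  · have e : digit ξ (n + 1) = 2 := by rw [abs_of_nonneg (by omega)] at h2; exact h2
    rw [e] at hm ⊢; push_cast at hm ⊢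
    nlinarith
  · have e : digit ξ (n + 1) = -2 := by rw [abs_of_nonpos (by omega)] at h2; omega
    rw [e] at hm ⊢; push_cast at hm ⊢
    nlinarith

/-! ### Approximation errors and ratios of consecutive denominators -/

theorem err_eq {ξ : ℝ} (h : Irrational ξ) (n : ℕ) :
    err ξ n = quotient ξ (n + 1) * err ξ (n + 1) := by
  induction n with
  | zero =>
    have h1 := quotient_succ_mul h 0
    simp only [err, den, num, quotient] at h1 ⊢
    push_cast; linarith
  | succ n ih =>
    have h1 := quotient_succ_mul h (n + 1)
    have h2 : err ξ (n + 2) = digit ξ (n + 1) * err ξ (n + 1) - err ξ n := by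
      simp only [err, den, num]; push_cast; ring
    rw [h2, ih]
    linear_combination (-err ξ (n + 1)) * h1

theorem err_ne_zero {ξ : ℝ} (h : Irrational ξ) (n : ℕ) : err ξ n ≠ 0 := by
  induction n with
  | zero => simp [err, den, num]
  | succ n ih =>
    intro h0
    rw [err_eq h n, h0, mul_zero] at ih
    exact ih rfl

theorem den_mul_err (ξ : ℝ) (n : ℕ) :
    den ξ n * err ξ (n + 1) - den ξ (n + 1) * err ξ n = 1 := by
  have h := num_mul_den ξ n
  have h' : (num ξ n : ℝ) * den ξ (n + 1) - num ξ (n + 1) * den ξ n = 1 := by exact_mod_cast h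
  simp only [err]; linarith

theorem ratio_zero (ξ : ℝ) : ratio ξ 0 = 0 := by simp [ratio, den]

/-- The sign-independent form of the invariants of the ratios of denominators. -/
theorem ratio_invariant {ξ : ℝ} (h : Irrational ξ) (n : ℕ) :
    den ξ (n + 1) ≠ 0 ∧ |ratio ξ n| ≤ 1 - lam ∧
      (lam < |ratio ξ n| → ratio ξ n * quotient ξ (n + 1) < 0) ∧
      (0 < ratio ξ n * quotient ξ (n + 1) → ∃ k, n = k + 1 ∧ 3 ≤ |digit ξ n|) ∧
      (3 ≤ |digit ξ n| → |ratio ξ n| ≤ lam) := by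
  have hl := lam_gt
  have hl' := lam_lt
  have hsq := lam_sq
  induction n with
  | zero =>
      simp only [ratio_zero, den, abs_zero, zero_mul]
      exact ⟨one_ne_zero, by linarith, fun _ => by linarith, fun h => absurd h (lt_irrefl _),
        fun _ => by linarith⟩
  | succ n ih =>
    obtain ⟨h0, h1, h2, -, -⟩ := ih
    have h0' : (den ξ (n + 1) : ℝ) ≠ 0 := by exact_mod_cast h0
    have hd : (den ξ (n + 2) : ℝ) = den ξ (n + 1) * (digit ξ (n + 1) - ratio ξ n) := by
      simp only [den, ratio]; push_cast; field_simp
    -- The old ratio is either at most `lam` in size or opposite in sign to the next digit, so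
    -- subtracting it costs at most `lam`.
    have key : (|digit ξ (n + 1)| : ℝ) - lam ≤ |(digit ξ (n + 1) : ℝ) - ratio ξ n| ∧
        0 < digit ξ (n + 1) * ((digit ξ (n + 1) : ℝ) - ratio ξ n) := by
      have h1' := abs_le.1 h1
      rcases digit_cases h n with ⟨hq, hD⟩ | ⟨hq, hD⟩
      · have hD' : (2 : ℝ) ≤ digit ξ (n + 1) := by exact_mod_cast hD
        have : ratio ξ n ≤ lam := by
          by_contra! h3
          have := h2 (h3.trans_le (le_abs_self _))
          nlinarith
        rw [abs_of_pos (by linarith : (0 : ℝ) < digit ξ (n + 1)), abs_of_pos (by linarith)]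
        exact ⟨by linarith, by apply mul_pos <;> linarith⟩
      · have hD' : (digit ξ (n + 1) : ℝ) ≤ -2 := by exact_mod_cast hD
        have : -lam ≤ ratio ξ n := by
          by_contra! h3
          have := h2 (by rw [lt_abs]; right; linarith)
          nlinarith
        rw [abs_of_neg (by linarith : (digit ξ (n + 1) : ℝ) < 0), abs_of_neg (by linarith)]
        exact ⟨by linarith, by apply mul_pos_of_neg_of_neg <;> linarith⟩
    obtain ⟨k1, k2⟩ := key
    have k0 : (digit ξ (n + 1) : ℝ) - ratio ξ n ≠ 0 := by
      intro h3; rw [h3] at k2; simp at k2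
    have hr : ratio ξ (n + 1) = ((digit ξ (n + 1) : ℝ) - ratio ξ n)⁻¹ := by
      rw [ratio, hd]; field_simp
    have hrd : 0 < digit ξ (n + 1) * ratio ξ (n + 1) := by
      rw [hr]
      have : (digit ξ (n + 1) : ℝ) * ((digit ξ (n + 1) : ℝ) - ratio ξ n)⁻¹
        = digit ξ (n + 1) * ((digit ξ (n + 1) : ℝ) - ratio ξ n) *
          (((digit ξ (n + 1) : ℝ) - ratio ξ n)⁻¹) ^ 2 := by field_simp
      rw [this]; positivity
    have h2D : (2 : ℝ) ≤ |(digit ξ (n + 1) : ℝ)| := by exact_mod_cast two_le_abs_digit h n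
    have hra : |ratio ξ (n + 1)| * |(digit ξ (n + 1) : ℝ) - ratio ξ n| = 1 := by
      rw [hr, abs_inv]; exact inv_mul_cancel₀ (abs_ne_zero.2 k0)
    -- The relation `lam ^ 2 = 3 * lam - 1` says `1 / (3 - lam) = lam` and `1 / (2 - lam) = 1 -
    -- lam`, which makes both bounds reproduce themselves.
    have h3D : 3 ≤ |digit ξ (n + 1)| → |ratio ξ (n + 1)| ≤ lam := by
      intro h3
      have h3' : (3 : ℝ) ≤ |(digit ξ (n + 1) : ℝ)| := by exact_mod_cast h3
      by_contra! h4
      nlinarith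
    -- The new ratio has the sign of the digit just used, and a digit `±2` is followed by the
    -- opposite sign.
    have hneg : |digit ξ (n + 1)| = 2 → ratio ξ (n + 1) * quotient ξ (n + 2) < 0 := by
      intro h2'
      have h5 := quotient_neg_of_digit_eq_two h n h2'
      by_contra! h6
      nlinarith [mul_neg_of_pos_of_neg hrd h5, mul_nonneg (sq_nonneg (digit ξ (n + 1) : ℝ)) h6]
    have hcase : |digit ξ (n + 1)| = 2 ∨ 3 ≤ |digit ξ (n + 1)| := by
      have := two_le_abs_digit h n; omega
    refine ⟨?_, ?_, ?_, ?_, h3D⟩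
    · have : (den ξ (n + 2) : ℝ) ≠ 0 := by rw [hd]; exact mul_ne_zero h0' k0
      exact_mod_cast this
    · by_contra! h4
      nlinarith
    · intro h4
      rcases hcase with h5 | h5
      · exact hneg h5
      · exact absurd (h3D h5) (not_le.2 h4)
    · intro h4
      rcases hcase with h5 | h5
      · exact absurd (hneg h5) (by linarith)
      · exact ⟨n, rfl, h5⟩

theorem den_succ_ne {ξ : ℝ} (h : Irrational ξ) (n : ℕ) : (den ξ (n + 1) : ℝ) ≠ 0 := by
  exact_mod_cast (ratio_invariant h n).1

theorem den_add_two {ξ : ℝ} (h : Irrational ξ) (n : ℕ) :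
    (den ξ (n + 2) : ℝ) = den ξ (n + 1) * (digit ξ (n + 1) - ratio ξ n) := by
  have := den_succ_ne h n
  simp only [den, ratio]; push_cast; field_simp

theorem ratio_succ_mul {ξ : ℝ} (h : Irrational ξ) (n : ℕ) :
    ratio ξ (n + 1) * (digit ξ (n + 1) - ratio ξ n) = 1 := by
  have h1 := den_succ_ne h n
  have h2 := den_succ_ne h (n + 1)
  have h3 := den_add_two h n
  rw [ratio, div_mul_eq_mul_div, ← h3, div_self h2]

/-- The distance from the ratio to a number close to the next digit. -/
theorem abs_sub_ratio_ge {ξ : ℝ} (h : Irrational ξ) (n : ℕ) {x : ℝ}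
    (hx : 0 < x * quotient ξ (n + 1)) : |x| - lam ≤ |x - ratio ξ n| := by
  obtain ⟨-, h1, h2, -, -⟩ := ratio_invariant h n
  have hl := lam_gt
  rcases le_or_gt |ratio ξ n| lam with h3 | h3
  · have := abs_sub_abs_le_abs_sub x (ratio ξ n); linarith
  · have h4 := h2 h3
    have h5 : x * ratio ξ n < 0 := by
      by_contra! h6
      nlinarith [mul_neg_of_pos_of_neg hx h4, mul_nonneg h6 (sq_nonneg (quotient ξ (n + 1)))]
    have : |x| ≤ |x - ratio ξ n| := by
      apply sq_le_sq.1; nlinarith [sq_nonneg (ratio ξ n)]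
    linarith

theorem digit_mul_quotient_pos {ξ : ℝ} (h : Irrational ξ) (n : ℕ) :
    0 < (digit ξ (n + 1) : ℝ) * quotient ξ (n + 1) := by
  rcases digit_cases h n with ⟨hq, hD⟩ | ⟨hq, hD⟩
  · have hD' : (2 : ℝ) ≤ digit ξ (n + 1) := by exact_mod_cast hD
    apply mul_pos <;> linarith
  · have hD' : (digit ξ (n + 1) : ℝ) ≤ -2 := by exact_mod_cast hD
    apply mul_pos_of_neg_of_neg <;> linarith

theorem two_le_abs_digit_real {ξ : ℝ} (h : Irrational ξ) (n : ℕ) :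
    2 ≤ |(digit ξ (n + 1) : ℝ)| := by exact_mod_cast two_le_abs_digit h n

theorem abs_digit_sub_ratio_ge {ξ : ℝ} (h : Irrational ξ) (n : ℕ) :
    |(digit ξ (n + 1) : ℝ)| - lam ≤ |digit ξ (n + 1) - ratio ξ n| :=
  abs_sub_ratio_ge h n (digit_mul_quotient_pos h n)

theorem abs_digit_sub_ratio_of_pos {ξ : ℝ} (h : Irrational ξ) (n : ℕ)
    (hs : 0 < ratio ξ n * quotient ξ (n + 1)) :
    |(digit ξ (n + 1) : ℝ) - ratio ξ n| = |(digit ξ (n + 1) : ℝ)| - |ratio ξ n| := by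
  have h1 := abs_le.1 (ratio_invariant h n).2.1
  have hl := lam_gt
  rcases digit_cases h n with ⟨hq, hD⟩ | ⟨hq, hD⟩
  · have hD' : (2 : ℝ) ≤ digit ξ (n + 1) := by exact_mod_cast hD
    have : 0 < ratio ξ n := by by_contra! h2; nlinarith
    rw [abs_of_pos this, abs_of_pos (by linarith), abs_of_pos (by linarith)]
  · have hD' : (digit ξ (n + 1) : ℝ) ≤ -2 := by exact_mod_cast hD
    have : ratio ξ n < 0 := by by_contra! h2; nlinarith
    rw [abs_of_neg this, abs_of_neg (by linarith), abs_of_neg (by linarith)]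
    ring

theorem abs_digit_le_abs_sub_ratio {ξ : ℝ} (h : Irrational ξ) (n : ℕ)
    (hs : ratio ξ n * quotient ξ (n + 1) ≤ 0) :
    |(digit ξ (n + 1) : ℝ)| ≤ |(digit ξ (n + 1) : ℝ) - ratio ξ n| := by
  rcases digit_cases h n with ⟨hq, hD⟩ | ⟨hq, hD⟩
  · have hD' : (2 : ℝ) ≤ digit ξ (n + 1) := by exact_mod_cast hD
    have : ratio ξ n ≤ 0 := by by_contra! h2; nlinarith
    rw [abs_of_pos (by linarith), abs_of_pos (by linarith)]
    linarith
  · have hD' : (digit ξ (n + 1) : ℝ) ≤ -2 := by exact_mod_cast hD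
    have : 0 ≤ ratio ξ n := by by_contra! h2; nlinarith
    rw [abs_of_neg (by linarith), abs_of_neg (by linarith)]
    linarith

theorem abs_den_add_two_ge {ξ : ℝ} (h : Irrational ξ) (n : ℕ) :
    |(den ξ (n + 1) : ℝ)| * (|(digit ξ (n + 1) : ℝ)| - lam) ≤ |(den ξ (n + 2) : ℝ)| := by
  rw [den_add_two h n, abs_mul]
  exact mul_le_mul_of_nonneg_left (abs_digit_sub_ratio_ge h n) (abs_nonneg _)

theorem abs_den_lt {ξ : ℝ} (h : Irrational ξ) (n : ℕ) : |den ξ n| < |den ξ (n + 1)| := by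
  cases n with
  | zero => simp [den]
  | succ n =>
    have h1 := abs_den_add_two_ge h n
    have h2 := two_le_abs_digit_real h n
    have h3 := abs_pos.2 (den_succ_ne h n)
    have h4 := lam_lt
    have : |(den ξ (n + 1) : ℝ)| < |(den ξ (n + 2) : ℝ)| := by nlinarith
    exact_mod_cast this

theorem abs_den_strictMono {ξ : ℝ} (h : Irrational ξ) : StrictMono fun n => |den ξ n| :=
  strictMono_nat_of_lt_succ (abs_den_lt h)

theorem intCast_le_abs_den {ξ : ℝ} (h : Irrational ξ) (n : ℕ) : (n : ℤ) ≤ |den ξ n| := by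
  induction n with
  | zero => simp
  | succ n ih => have := abs_den_lt h n; push_cast; omega

theorem le_abs_den {ξ : ℝ} (h : Irrational ξ) (n : ℕ) : (n : ℝ) ≤ |(den ξ n : ℝ)| := by
  exact_mod_cast intCast_le_abs_den h n

/-- `q |q ξ - p| = 1 / |ξₘ - s|` for the convergent `p / q`. -/
theorem abs_den_mul_err {ξ : ℝ} (h : Irrational ξ) (n : ℕ) :
    |(den ξ (n + 1) : ℝ) * err ξ (n + 1)| * |quotient ξ (n + 1) - ratio ξ n| = 1 := by
  have h1 := den_mul_err ξ n
  have h2 := den_succ_ne h n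
  rw [err_eq h n] at h1
  rw [← abs_mul, ← abs_neg]
  have : -(den ξ (n + 1) * err ξ (n + 1) * (quotient ξ (n + 1) - ratio ξ n)) = 1 := by
    rw [← h1, ratio]; field_simp; ring
  rw [this, abs_one]

/-! ### Good approximations are convergents -/

/-- The tight case is `A = b = 1`, where `(1 - s) * (1 - t)` meets `lam * (1 - s * t)` at `s = 1 -
lam`, `t = 0` and at `s = lam`, `t = 1/2`. This is why `hst` is needed and why the constant is
`lam`. The other pairs `A`, `b` leave room. -/
theorem lam_mul_le_of_pos {s t : ℝ} {A b : ℤ} (hs0 : 0 < s) (hs : s ≤ 1 - lam) (ht : |t| ≤ 1 / 2)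
    (hst : 0 < t → s ≤ lam) (hA : 1 ≤ A) (hb : 1 ≤ b) (h1 : |A * s - b| < 1)
    (h2 : s ≤ |A * s - b|) : lam * (1 - s * t) ≤ |A * s - b| * |A - b * t| := by
  have hl := lam_gt
  have hl' := lam_lt
  have hsq := lam_sq
  obtain ⟨ht1, ht2⟩ := abs_le.1 ht
  have hst1 : |s * t| ≤ s * (1 / 2) := by
    rw [abs_mul, abs_of_pos hs0]; exact mul_le_mul_of_nonneg_left ht hs0.le
  obtain ⟨hst2, hst3⟩ := abs_le.1 hst1
  obtain ⟨h3, h4⟩ := abs_lt.1 h1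
  rcases hA.eq_or_lt with hA1 | hA2
  · subst hA1
    have hb1 : b = 1 := by
      have : (b : ℝ) < ((2 : ℤ) : ℝ) := by push_cast at h3 h4 ⊢; linarith
      have := Int.cast_lt.1 this; omega
    subst hb1
    push_cast
    rw [abs_of_neg (by linarith : 1 * s - 1 < 0), abs_of_pos (by linarith : 0 < 1 - 1 * t)]
    rcases le_or_gt t 0 with h5 | h5
    · nlinarith [mul_nonneg (by linarith : 0 ≤ 1 - lam - s) (by linarith : 0 ≤ -t)]
    · have h6 := hst h5
      have : (1 - s) * (1 / 2) - lam * (1 - s / 2) = (lam - s) * (1 - lam) / 2 := by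
        nlinarith
      nlinarith [mul_nonneg (by linarith : 0 ≤ lam - s) (by linarith : 0 ≤ 1 - lam),
        mul_nonneg (by nlinarith : 0 ≤ 1 - s - lam * s) (by linarith : 0 ≤ 1 / 2 - t)]
  have hA2' : (2 : ℝ) ≤ A := by exact_mod_cast hA2
  rcases hb.eq_or_lt with hb1 | hb2
  · subst hb1
    push_cast at *
    rw [abs_of_pos (by linarith : 0 < (A : ℝ) - 1 * t)]
    rcases le_abs.1 h2 with h5 | h5
    · refine le_trans ?_ (mul_le_mul_of_nonneg_right (le_abs_self _) (by linarith))
      have : s * (1 - s * t) ≤ (A * s - 1) * (A - 1 * t) * s := by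
        nlinarith [mul_le_mul_of_nonneg_right h5 (by linarith : 0 ≤ 1 - s * t),
          sq_nonneg (A * s - 1)]
      have : 1 - s * t ≤ (A * s - 1) * (A - 1 * t) := by
        refine le_of_mul_le_mul_right ?_ hs0; linarith
      nlinarith
    · refine le_trans ?_ (mul_le_mul_of_nonneg_right (neg_le_abs _) (by linarith))
      have h6 : (A + 1) * s ≤ 1 := by linarith
      have h7 : s ≤ 1 / 3 := by nlinarith
      have h8 : 1 ≤ -(A * s - 1) * (A + 1) := by nlinarith
      have : 1 / 2 ≤ -(A * s - 1) * (A - 1 * t) := by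
        nlinarith [mul_nonneg (by linarith : 0 ≤ -(A * s - 1)) (by linarith : 0 ≤ 1 / 2 - t)]
      nlinarith
  · have hb2' : (2 : ℝ) ≤ b := by exact_mod_cast hb2
    have h5 : 2 * (1 - s * t) - 1 ≤ s * |A - b * t| := by
      have : s * |A - b * t| = |s * (A - b * t)| := by rw [abs_mul, abs_of_pos hs0]
      rw [this]
      refine le_trans ?_ (le_abs_self _)
      nlinarith [mul_nonneg (by linarith : 0 ≤ (b : ℝ) - 2) (by linarith : 0 ≤ 1 - s * t)]
    have h6 : s * |A - b * t| ≤ |A * s - b| * |A - b * t| :=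
      mul_le_mul_of_nonneg_right h2 (abs_nonneg _)
    nlinarith

theorem lam_mul_le {s t : ℝ} {A B : ℤ} (hs : |s| ≤ 1 - lam) (ht : |t| ≤ 1 / 2)
    (hst : 0 < s * t → |s| ≤ lam) (hA : A ≠ 0) (hB : B ≠ 0) (h1 : |A * s + B| < 1)
    (h2 : |s| ≤ |A * s + B|) : lam * (1 - s * t) ≤ |A * s + B| * |A + B * t| := by
  wlog hA1 : 1 ≤ A generalizing A B
  · have e1 : |((-A : ℤ) : ℝ) * s + ((-B : ℤ) : ℝ)| = |A * s + B| := by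
      rw [← abs_neg]; push_cast; congr 1; ring
    have e2 : |((-A : ℤ) : ℝ) + ((-B : ℤ) : ℝ) * t| = |A + B * t| := by
      rw [← abs_neg]; push_cast; congr 1; ring
    have := this (A := -A) (B := -B) (by omega) (by omega) (by rw [e1]; exact h1)
      (by rw [e1]; exact h2) (by omega)
    rwa [e1, e2] at this
  have hA1' : (1 : ℝ) ≤ A := by exact_mod_cast hA1
  have hBcases : 1 ≤ B ∨ B ≤ -1 := by omega
  obtain ⟨h3, h4⟩ := abs_lt.1 h1
  rcases lt_trichotomy s 0 with h0 | h0 | h0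
  · have hB1 : 1 ≤ B := by
      refine hBcases.resolve_right fun h => ?_
      have : (B : ℝ) ≤ -1 := by exact_mod_cast h
      nlinarith
    rw [abs_of_neg h0] at hs hst h2
    have e1 : |(A : ℝ) * -s - B| = |A * s + B| := by rw [← abs_neg]; congr 1; ring
    have := lam_mul_le_of_pos (s := -s) (t := -t) (A := A) (b := B) (by linarith) hs
      (by rwa [abs_neg]) (fun h => hst (by nlinarith)) hA1 hB1 (by rwa [e1]) (by rwa [e1])
    rw [e1] at this
    simpa using this
  · subst h0
    have : (1 : ℝ) ≤ |(B : ℝ)| := by exact_mod_cast Int.one_le_abs hB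
    simp at h1; linarith
  · have hB1 : 1 ≤ -B := by
      suffices B ≤ -1 by omega
      refine hBcases.resolve_left fun h => ?_
      have : (1 : ℝ) ≤ B := by exact_mod_cast h
      nlinarith
    rw [abs_of_pos h0] at hs hst h2
    have := lam_mul_le_of_pos (s := s) (t := t) (A := A) (b := -B) h0 hs ht
      (fun h => hst (by positivity)) hA1 hB1 (by simpa using h1) (by simpa using h2)
    simpa using this

/-- Legendre's theorem for the nearest integer algorithm. -/
theorem eq_convergent {ξ : ℝ} (h : Irrational ξ) {p q : ℤ} (hpq : Int.gcd p q = 1) (hq : q ≠ 0)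
    (hlt : |(q : ℝ) * (q * ξ - p)| < lam) :
    ∃ m, (p = num ξ (m + 1) ∧ q = den ξ (m + 1)) ∨ (p = -num ξ (m + 1) ∧ q = -den ξ (m + 1)) := by
  have hex : ∃ k, |q| < |den ξ k| := by
    refine ⟨q.natAbs + 1, ?_⟩
    have := intCast_le_abs_den h (q.natAbs + 1)
    have := Int.natCast_natAbs q
    push_cast at *; omega
  -- Locate `|q|` between consecutive denominators. The first denominator exceeding it has index at
  -- least `2`, because `den ξ 0 = 0` and `den ξ 1 = 1`.
  obtain ⟨m, hm, hm'⟩ : ∃ m, |den ξ (m + 1)| ≤ |q| ∧ |q| < |den ξ (m + 2)| := by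
    classical
    have hk := Nat.find_spec hex
    obtain ⟨k, hkeq⟩ : ∃ k, Nat.find hex = k + 2 := by
      refine ⟨Nat.find hex - 2, ?_⟩
      have h0 : Nat.find hex ≠ 0 := by 
        intro h0; rw [h0, den, abs_zero] at hk; exact absurd hk (abs_nonneg q).not_gt
      have h1 : Nat.find hex ≠ 1 := by
        intro h1; rw [h1] at hk; simp [den] at hk; exact hq hk
      omega
    rw [hkeq] at hk
    exact ⟨k, not_lt.1 (Nat.find_min hex (by omega)), hk⟩
  have hdet := num_mul_den ξ (m + 1)
  -- Coordinates of `(p, q)` in the unimodular basis of two consecutive convergents. `B = 0` gives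
  -- the convergent up to sign; otherwise `lam_mul_le` contradicts `hlt`.
  set A := p * den ξ (m + 2) - q * num ξ (m + 2) with hAdef
  set B := q * num ξ (m + 1) - p * den ξ (m + 1) with hBdef
  have hp' : p = A * num ξ (m + 1) + B * num ξ (m + 2) := by
    rw [hAdef, hBdef]; linear_combination (-p) * hdet
  have hq' : q = A * den ξ (m + 1) + B * den ξ (m + 2) := by
    rw [hAdef, hBdef]; linear_combination (-q) * hdet
  refine ⟨m, ?_⟩
  by_cases hB : B = 0
  · rw [hB, zero_mul, add_zero] at hp' hq'
    have : A ∣ 1 := by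
      have := Int.dvd_coe_gcd (Dvd.intro _ hp'.symm) (Dvd.intro _ hq'.symm)
      rwa [hpq] at this
    rcases Int.isUnit_iff.1 (isUnit_of_dvd_one this) with h1 | h1
    · left; rw [h1] at hp' hq'; exact ⟨by linarith, by linarith⟩
    · right; rw [h1] at hp' hq'; exact ⟨by linarith, by linarith⟩
  exfalso
  have hA : A ≠ 0 := by
    intro h0
    rw [h0, zero_mul, zero_add] at hq'
    rw [hq', abs_mul] at hm'
    have := Int.one_le_abs hB
    nlinarith [abs_nonneg (den ξ (m + 2))]
  obtain ⟨-, hs, hst, -, -⟩ := ratio_invariant h (m + 1)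
  have hQ := two_lt_abs_quotient h (m + 1)
  have hQ0 : quotient ξ (m + 2) ≠ 0 := by intro h0; rw [h0] at hQ; simp at hQ; linarith
  have hd := den_succ_ne h (m + 1)
  have hda := abs_pos.2 hd
  have he : err ξ (m + 2) = err ξ (m + 1) * (quotient ξ (m + 2))⁻¹ := by
    rw [err_eq h (m + 1)]; field_simp
  have hr : (den ξ (m + 1) : ℝ) = den ξ (m + 2) * ratio ξ (m + 1) := by rw [ratio]; field_simp
  set s := ratio ξ (m + 1)
  set t := (quotient ξ (m + 2))⁻¹ with htdef
  have ht : |t| ≤ 1 / 2 := by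
    rw [htdef, abs_inv, one_div]; exact inv_anti₀ (by norm_num) hQ.le
  have hqr : (q : ℝ) = den ξ (m + 2) * (A * s + B) := by
    have : (q : ℝ) = A * den ξ (m + 1) + B * den ξ (m + 2) := by exact_mod_cast hq'
    rw [this, hr]; ring
  have hLr : q * ξ - p = err ξ (m + 1) * (A + B * t) := by
    have h1 : (q : ℝ) = A * den ξ (m + 1) + B * den ξ (m + 2) := by exact_mod_cast hq'
    have h2 : (p : ℝ) = A * num ξ (m + 1) + B * num ξ (m + 2) := by exact_mod_cast hp'
    have h3 : q * ξ - p = A * err ξ (m + 1) + B * err ξ (m + 2) := by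
      rw [h1, h2]; simp only [err]; ring
    rw [h3, he]; ring
  have hm1 : |(den ξ (m + 1) : ℝ)| ≤ |(q : ℝ)| := by exact_mod_cast hm
  have hm2 : |(q : ℝ)| < |(den ξ (m + 2) : ℝ)| := by exact_mod_cast hm'
  rw [hr, hqr, abs_mul, abs_mul] at hm1
  rw [hqr, abs_mul] at hm2
  have key := lam_mul_le (s := s) (t := t) hs ht (fun h1 => by
    by_contra! h2
    have h3 := hst h2
    have : s * t = s * quotient ξ (m + 2) * t ^ 2 := by rw [htdef]; field_simp
    rw [this] at h1
    nlinarith [sq_nonneg t]) hA hB (by nlinarith) (le_of_mul_le_mul_left hm1 hda)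
  -- The determinant relation normalises the product of denominator and error, so that `key` becomes
  -- a lower bound by `lam`.
  have hdet2 : den ξ (m + 2) * err ξ (m + 1) * (1 - s * t) = -1 := by
    have := den_mul_err ξ (m + 1)
    rw [he, hr] at this; linarith
  have hst1 : 0 < 1 - s * t := by
    have h1 : |s * t| ≤ 1 * (1 / 2) := by
      rw [abs_mul]; exact mul_le_mul (by linarith [lam_gt]) ht (abs_nonneg _) (by norm_num)
    linarith [(abs_le.1 h1).2]
  have hdet3 : |den ξ (m + 2) * err ξ (m + 1)| * (1 - s * t) = 1 := by
    rw [← abs_of_pos hst1, ← abs_mul, hdet2]; simp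
  have : |(q : ℝ) * (q * ξ - p)|
      = |den ξ (m + 2) * err ξ (m + 1)| * (|A * s + B| * |A + B * t|) := by
    rw [hLr, hqr, ← abs_mul, ← abs_mul]; congr 1; ring
  rw [this] at hlt
  have := mul_le_mul_of_nonneg_left key (abs_nonneg (den ξ (m + 2) * err ξ (m + 1)))
  rw [mul_left_comm, hdet3, mul_one] at this
  linarith

/-! ### Growth of the denominators -/

theorem log_den_add_two {ξ : ℝ} (h : Irrational ξ) (n : ℕ) :
    Real.log |(den ξ (n + 2) : ℝ)|
      = Real.log |(den ξ (n + 1) : ℝ)| + Real.log |digit ξ (n + 1) - ratio ξ n| := by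
  rw [den_add_two h n, abs_mul, Real.log_mul (abs_ne_zero.2 (den_succ_ne h n))]
  have := abs_digit_sub_ratio_ge h n
  have := two_le_abs_digit_real h n
  have := lam_lt
  linarith

/-- Each factor is at most `|a| + |s| ≤ 2 |a|`. The loss of `log 2` per step is affordable because
it is strictly below `c0`. -/
theorem log_den_le {ξ : ℝ} (h : Irrational ξ) (n : ℕ) :
    Real.log |(den ξ (n + 1) : ℝ)| ≤ alphaSum ξ (n + 1) + n * Real.log 2 := by
  have h0 : ∀ n, Real.log |(den ξ (n + 1) : ℝ)|
      ≤ ∑ j ∈ Finset.range n, Real.log |(digit ξ (j + 1) : ℝ)| + n * Real.log 2 := by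
    intro n
    induction n with
    | zero => simp [den]
    | succ n ih =>
      rw [log_den_add_two h n, Finset.sum_range_succ]
      have h1 := abs_digit_sub_ratio_ge h n
      have h2 := two_le_abs_digit_real h n
      have h3 := lam_lt
      have h4 := lam_gt
      have h5 : |digit ξ (n + 1) - ratio ξ n| ≤ |(digit ξ (n + 1) : ℝ)| * 2 := by
        have := abs_sub (digit ξ (n + 1) : ℝ) (ratio ξ n)
        have := (ratio_invariant h n).2.1
        linarith
      have h6 := Real.log_le_log (by linarith) h5
      rw [Real.log_mul (by linarith) (by norm_num)] at h6
      push_cast; linarith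
  have h1 := h0 n
  have h2 : 0 ≤ Real.log |(digit ξ 0 : ℝ)| := by
    rw [Real.log_abs]; exact Real.log_intCast_nonneg _
  rw [alphaSum, Finset.sum_range_succ']
  linarith

theorem eta_pos : 0 < eta := by
  unfold eta
  exact div_pos (Real.log_pos (by norm_num))
    (mul_pos (by norm_num) (Real.log_pos (by norm_num)))

theorem eta_le : eta ≤ 1 / 2 := by
  unfold eta
  have h1 : 0 < Real.log 3 := Real.log_pos (by norm_num)
  have h2 : Real.log (9 / 5) ≤ Real.log 3 := Real.log_le_log (by norm_num) (by norm_num)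
  rw [div_le_iff₀ (by linarith)]; linarith

/-- Already `|a| ≤ (|a| - lam) ^ 2` for `|a| ≥ 2`, so half of `log |a|` is gained at each step, and
`eta ≤ 1 / 2`. The constant absorbs the digit of index `0`. -/
theorem eta_mul_alphaSum_le {ξ : ℝ} (h : Irrational ξ) :
    ∃ C, ∀ n, eta * alphaSum ξ (n + 1) ≤ Real.log |(den ξ (n + 1) : ℝ)| + C := by
  refine ⟨eta * Real.log |(digit ξ 0 : ℝ)|, fun n => ?_⟩
  rw [alphaSum, Finset.sum_range_succ', mul_add]
  gcongr
  induction n with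
  | zero => simp [den]
  | succ n ih =>
    rw [log_den_add_two h n, Finset.sum_range_succ, mul_add]
    have h1 := abs_digit_sub_ratio_ge h n
    have h2 := two_le_abs_digit_real h n
    have h3 := lam_lt
    have h4 := lam_gt
    have h5 : Real.log |(digit ξ (n + 1) : ℝ)| ≤ 2 * Real.log |digit ξ (n + 1) - ratio ξ n| := by
      have : 2 * Real.log |digit ξ (n + 1) - ratio ξ n|
          = Real.log (|digit ξ (n + 1) - ratio ξ n| ^ 2) := by rw [Real.log_pow]; norm_num
      rw [this]
      exact Real.log_le_log (by linarith) (by nlinarith)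
    have h6 : 0 ≤ Real.log |(digit ξ (n + 1) : ℝ)| := Real.log_nonneg (by linarith)
    nlinarith [eta_le]

/-- The distance is at most `2 * log 2`, since its hyperbolic cosine is at most `2 ≤ 17 / 8 = cosh
(2 * log 2)`. Nonnegativity is all that the growth bound needs from `chi`. -/
theorem chi_nonneg : 0 ≤ chi := by
  have h5 : 2.236 < √5 := (Real.lt_sqrt (by norm_num)).2 (by norm_num)
  have h5' : √5 < 2.237 := (Real.sqrt_lt' (by norm_num)).2 (by norm_num)
  have h3 : 1.732 < √3 := (Real.lt_sqrt (by norm_num)).2 (by norm_num)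
  have h3' : √3 < 1.733 := (Real.sqrt_lt' (by norm_num)).2 (by norm_num)
  have hm : 0.74 < mu := by unfold mu; linarith
  have hm' : mu < 0.741 := by unfold mu; linarith
  have hs : 0.67 < √(1 - mu ^ 2) := (Real.lt_sqrt (by norm_num)).2 (by nlinarith)
  have hs' : √(1 - mu ^ 2) < 0.68 := (Real.sqrt_lt' (by norm_num)).2 (by nlinarith)
  have hc : Real.cosh (dist pointA pointB) ≤ Real.cosh (2 * Real.log 2) := by
    have e1 : Real.cosh (2 * Real.log 2) = 17 / 8 := by
      rw [Real.cosh_eq, Real.exp_neg, two_mul, Real.exp_add, Real.exp_log (by norm_num)]; norm_num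
    rw [e1, UpperHalfPlane.cosh_dist, Complex.dist_eq, Complex.sq_norm, Complex.normSq_apply]
    have a1 : ((pointA : ℂ) - (pointB : ℂ)).re = mu - 3 / 2 := rfl
    have a2 : ((pointA : ℂ) - (pointB : ℂ)).im = √(1 - mu ^ 2) - √3 / 2 := rfl
    have a3 : pointA.im = √(1 - mu ^ 2) := rfl
    have a4 : pointB.im = √3 / 2 := rfl
    rw [a1, a2, a3, a4]
    have : ((mu - 3 / 2) * (mu - 3 / 2) + (√(1 - mu ^ 2) - √3 / 2) * (√(1 - mu ^ 2) - √3 / 2)) /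
        (2 * √(1 - mu ^ 2) * (√3 / 2)) ≤ 1 := by
      rw [div_le_one (by nlinarith)]
      nlinarith
    linarith
  rw [Real.cosh_le_cosh, abs_of_nonneg dist_nonneg,
    abs_of_nonneg (by have := Real.log_nonneg (show (1 : ℝ) ≤ 2 by norm_num); linarith)] at hc
  unfold chi; linarith

/-- Only a digit `±2` with a ratio of the same sign can shrink the factor below what is subtracted,
and it must follow a digit of size at least `3`. Such a digit has a surplus, because its `χⱼ` is at
least `log 2`; the surplus is saved and spent on the next digit. -/
theorem omegaSum_le {ξ : ℝ} (h : Irrational ξ) :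
    ∃ C, ∀ n, omegaSum ξ (n + 1) ≤ Real.log |(den ξ (n + 1) : ℝ)| + C := by
  refine ⟨Real.log |(digit ξ 0 : ℝ)| - chiSeq ξ 0, fun n => ?_⟩
  rw [omegaSum, Finset.sum_range_succ']
  gcongr
  have hl := lam_lt
  have hl' := lam_gt
  have hsq := lam_sq
  -- The second conjunct is the saved amount `log (2 * (1 - lam))`. It pays exactly for a factor `2
  -- - lam` in place of `2`, since `(1 - lam) * (2 - lam) = 1`.
  suffices H : ∑ j ∈ Finset.range n, (Real.log |(digit ξ (j + 1) : ℝ)| - chiSeq ξ (j + 1))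
        ≤ Real.log |(den ξ (n + 1) : ℝ)| ∧
      ((∃ k, n = k + 1 ∧ 3 ≤ |digit ξ n|) →
        ∑ j ∈ Finset.range n, (Real.log |(digit ξ (j + 1) : ℝ)| - chiSeq ξ (j + 1))
          + Real.log (2 * (1 - lam)) ≤ Real.log |(den ξ (n + 1) : ℝ)|) from H.1
  induction n with
  | zero => simp [den]
  | succ n ih =>
    obtain ⟨ih1, ih2⟩ := ih
    have h1 := abs_digit_sub_ratio_ge h n
    have h2 := two_le_abs_digit_real h n
    have h2' := two_le_abs_digit h n
    rw [log_den_add_two h n, Finset.sum_range_succ]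
    have hh : 0 ≤ Real.log (2 * (1 - lam)) := Real.log_nonneg (by linarith)
    have hcase : |digit ξ (n + 1)| = 2 ∨ 3 ≤ |digit ξ (n + 1)| := by omega
    rcases hcase with h3 | h3
    · have h3' : |(digit ξ (n + 1) : ℝ)| = 2 := by exact_mod_cast h3
      refine ⟨?_, fun ⟨k, _, hk⟩ => by omega⟩
      have hchi : chiSeq ξ (n + 1) = chi := if_pos h3
      rw [hchi]
      have hchi0 := chi_nonneg
      rw [h3'] at h1 ⊢
      rcases lt_or_ge 0 (ratio ξ n * quotient ξ (n + 1)) with h4 | h4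
      · have h5 := ih2 ((ratio_invariant h n).2.2.2.1 h4)
        have h6 := Real.log_le_log (by linarith) h1
        have h7 : Real.log (2 * (1 - lam)) + Real.log (2 - lam) = Real.log 2 := by
          rw [← Real.log_mul (by linarith) (by linarith)]
          congr 1; linarith
        linarith
      · have h6 := abs_digit_le_abs_sub_ratio h n h4
        rw [h3'] at h6
        have := Real.log_le_log (by norm_num) h6
        linarith
    · have h3' : 3 ≤ |(digit ξ (n + 1) : ℝ)| := by exact_mod_cast h3
      have hchi : chiSeq ξ (n + 1) = Real.log (3 * √5) / 2 := if_neg (by omega)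
      have h5 : 2 ≤ √5 := Real.le_sqrt_of_sq_le (by norm_num)
      have h6 : 2 * Real.log 2 ≤ Real.log (3 * √5) := by
        have : 2 * Real.log 2 = Real.log (2 ^ 2) := by rw [Real.log_pow]; norm_num
        rw [this]; exact Real.log_le_log (by norm_num) (by linarith)
      have h7 : Real.log |(digit ξ (n + 1) : ℝ)| + Real.log (2 * (1 - lam))
          ≤ Real.log |digit ξ (n + 1) - ratio ξ n| + Real.log 2 := by
        rw [← Real.log_mul (by linarith) (by linarith), ← Real.log_mul (by linarith) (by norm_num)]
        apply Real.log_le_log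
        · apply mul_pos <;> linarith
        · nlinarith
      rw [hchi]
      exact ⟨by linarith, fun _ => by linarith⟩

theorem log_two_lt_c0 : Real.log 2 < c0 := by
  have h5 : 2 ≤ √5 := Real.le_sqrt_of_sq_le (by norm_num)
  have h6 : 2 * Real.log 2 < Real.log (3 * √5) := by
    have : 2 * Real.log 2 = Real.log (2 ^ 2) := by rw [Real.log_pow]; norm_num
    rw [this]; exact Real.log_lt_log (by norm_num) (by linarith)
  have h7 : 1 / 2 ≤ √(1 / 2) := Real.le_sqrt_of_sq_le (by norm_num)
  have h8 : 0 ≤ Real.log (3 / 4 + √(1 / 2)) := Real.log_nonneg (by linarith)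
  unfold c0; linarith

/-! ### Keeping the ratios away from their extreme value -/

theorem abs_ratio_succ {ξ : ℝ} (h : Irrational ξ) (n : ℕ) :
    |ratio ξ (n + 1)| * |digit ξ (n + 1) - ratio ξ n| = 1 := by
  rw [← abs_mul, ratio_succ_mul h n, abs_one]

theorem sq_den_add_two {ξ : ℝ} (h : Irrational ξ) (n : ℕ) :
    (den ξ (n + 2) : ℝ) ^ 2
      = (den ξ (n + 1) : ℝ) ^ 2 * |digit ξ (n + 1) - ratio ξ n| ^ 2 := by
  rw [den_add_two h n, mul_pow, sq_abs]

theorem natCast_sq_le_sq_den {ξ : ℝ} (h : Irrational ξ) {m n : ℕ} (hmn : m ≤ n) :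
    (m : ℝ) ^ 2 ≤ (den ξ n : ℝ) ^ 2 := by
  rw [← sq_abs (den ξ n : ℝ)]
  have h1 : (m : ℝ) ≤ n := by exact_mod_cast hmn
  exact pow_le_pow_left₀ (by positivity) (h1.trans (le_abs_den h n)) 2

/-- The scaled distance of the ratio to `lam` does not decrease along digits `3` of constant
sign, and is large otherwise. -/
theorem sq_den_mul_lam_sub {ξ : ℝ} (h : Irrational ξ) (n : ℕ) (h3 : 3 ≤ |digit ξ (n + 1)|) :
    (den ξ (n + 2) : ℝ) ^ 2 / 25 ≤ (den ξ (n + 2) : ℝ) ^ 2 * (lam - |ratio ξ (n + 1)|) ∨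
    (3 ≤ |digit ξ n| ∧ (den ξ (n + 1) : ℝ) ^ 2 * (lam - |ratio ξ n|)
        ≤ (den ξ (n + 2) : ℝ) ^ 2 * (lam - |ratio ξ (n + 1)|)) := by
  have hl := lam_gt
  have hl' := lam_lt
  have hsq := lam_sq
  have h1 := abs_ratio_succ h n
  have h2 := sq_den_add_two h n
  have hge := abs_digit_sub_ratio_ge h n
  have h3' : 3 ≤ |(digit ξ (n + 1) : ℝ)| := by exact_mod_cast h3
  have hsmall : 3 ≤ |digit ξ (n + 1) - ratio ξ n| →
      (den ξ (n + 2) : ℝ) ^ 2 / 25 ≤ (den ξ (n + 2) : ℝ) ^ 2 * (lam - |ratio ξ (n + 1)|) := by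
    intro h4
    have h5 : |ratio ξ (n + 1)| ≤ 1 / 3 := by nlinarith [abs_nonneg (ratio ξ (n + 1))]
    rw [div_eq_mul_inv]
    apply mul_le_mul_of_nonneg_left _ (sq_nonneg _)
    norm_num; linarith
  rcases le_or_gt 3 |digit ξ (n + 1) - ratio ξ n| with h4 | h4
  · exact Or.inl (hsmall h4)
  have h5 : |digit ξ (n + 1)| = 3 := by
    have : |(digit ξ (n + 1) : ℝ)| < ((4 : ℤ) : ℝ) := by push_cast; linarith
    have : |digit ξ (n + 1)| < 4 := by exact_mod_cast this
    omega
  have h5' : |(digit ξ (n + 1) : ℝ)| = 3 := by exact_mod_cast h5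
  have hpos : 0 < ratio ξ n * quotient ξ (n + 1) := by
    by_contra! h6
    have := abs_digit_le_abs_sub_ratio h n h6
    linarith
  obtain ⟨k, -, h6⟩ := (ratio_invariant h n).2.2.2.1 hpos
  have h7 := (ratio_invariant h n).2.2.2.2 h6
  refine Or.inr ⟨h6, ?_⟩
  rw [h2]
  rw [abs_digit_sub_ratio_of_pos h n hpos, h5'] at h1 ⊢
  set σ := |ratio ξ n|
  set τ := |ratio ξ (n + 1)|
  -- `lam` is fixed by `σ ↦ 1 / (3 - σ)`, so the distance to it contracts by `lam / (3 - σ)`, while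
  -- the squared denominator grows by `(3 - σ) ^ 2`. The net factor `lam * (3 - σ)` is at least `1`.
  have e : (den ξ (n + 1) : ℝ) ^ 2 * (3 - σ) ^ 2 * (lam - τ)
      = (den ξ (n + 1) : ℝ) ^ 2 * ((lam - σ) * (lam * (3 - σ))) := by
    linear_combination (-(den ξ (n + 1) : ℝ) ^ 2 * (3 - σ)) * (h1 + hsq)
  rw [e]
  apply mul_le_mul_of_nonneg_left _ (sq_nonneg _)
  apply le_mul_of_one_le_right (by linarith)
  nlinarith

/-- Going back along the digits, the scaled distance does not increase until a step where it is at
least a fixed fraction of the squared denominator. If no such step is met down to index `m`, all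
digits passed have size at least `3`. -/
theorem le_sq_den_mul_lam_sub {ξ : ℝ} (h : Irrational ξ) {K : ℝ} {m : ℕ}
    (hm : K ≤ (m : ℝ) ^ 2 / 25) {n : ℕ} (hn : m ≤ n + 1) (h3 : 3 ≤ |digit ξ (n + 1)|) :
    (∀ i, m ≤ i → i ≤ n + 1 → 3 ≤ |digit ξ i|) ∨
      K ≤ (den ξ (n + 2) : ℝ) ^ 2 * (lam - |ratio ξ (n + 1)|) := by
  induction n with
  | zero =>
    rcases sq_den_mul_lam_sub h 0 h3 with h1 | ⟨h1, -⟩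
    · right
      have := natCast_sq_le_sq_den h (show m ≤ 0 + 2 by omega)
      linarith
    · left
      intro i _ hi
      interval_cases i
      · exact h1
      · exact h3
  | succ n ih =>
    rcases sq_den_mul_lam_sub h (n + 1) h3 with h1 | ⟨h1, h2⟩
    · right
      have := natCast_sq_le_sq_den h (show m ≤ n + 1 + 2 by omega)
      linarith
    · rcases hn.eq_or_lt with hn | hn
      · left
        intro i hi hi'
        obtain rfl : i = n + 1 + 1 := by omega
        exact h3
      · rcases ih (by omega) h1 with h4 | h4
        · left
          intro i hi hi'
          rcases hi'.eq_or_lt with hi' | hi'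
          · rw [hi']; exact h3
          · exact h4 i hi (by omega)
        · right; linarith

/-- The ratios stay away from `1 - lam` on the scale of the squared denominators. -/
theorem sq_den_mul_one_sub_lam_sub {ξ : ℝ} (h : Irrational ξ) (K : ℝ) :
    ∃ m, ∀ n, m ≤ n → K ≤ (den ξ (n + 1) : ℝ) ^ 2 * (1 - lam - |ratio ξ n|) := by
  have hl := lam_gt
  have hl' := lam_lt
  have hsq := lam_sq
  obtain ⟨m, hm⟩ : ∃ m : ℕ, K ≤ (m : ℝ) ^ 2 / 25 := by
    obtain ⟨m, hm⟩ := exists_nat_ge (max 25 K)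
    refine ⟨m, ?_⟩
    have := (le_max_left 25 K).trans hm
    have := (le_max_right 25 K).trans hm
    nlinarith
  -- Either some digit beyond `m` has size below `3`, and the first alternative of
  -- `le_sq_den_mul_lam_sub` fails from then on, or all digits beyond `m` have size at least `3` and
  -- the ratios are eventually at most `lam`, well below `1 - lam`.
  obtain ⟨r, hr, hr'⟩ : ∃ r, m ≤ r ∧ ∀ n, r ≤ n → 3 ≤ |digit ξ (n + 1)| ∨
      ¬ ∀ i, m ≤ i → i ≤ n → 3 ≤ |digit ξ i| := by
    by_cases hex : ∃ i, m ≤ i ∧ ¬ 3 ≤ |digit ξ i|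
    · obtain ⟨i, hi, hi'⟩ := hex
      exact ⟨i, hi, fun n hn => Or.inr fun h0 => hi' (h0 i hi hn)⟩
    · push Not at hex
      exact ⟨m, le_rfl, fun n hn => Or.inl (hex _ (by omega))⟩
  refine ⟨r + 1, fun n' hn' => ?_⟩
  obtain ⟨n, rfl⟩ : ∃ n, n' = n + 1 := ⟨n' - 1, by omega⟩
  have h1 := abs_ratio_succ h n
  have h2 := sq_den_add_two h n
  have hsm : ∀ c : ℝ, 1 / 25 ≤ c → K ≤ (den ξ (n + 2) : ℝ) ^ 2 * c := by
    intro c hc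
    have := natCast_sq_le_sq_den h (show m ≤ n + 2 by omega)
    nlinarith [sq_nonneg (den ξ (n + 2) : ℝ)]
  rcases le_or_gt 3 |digit ξ (n + 1)| with h3 | h3
  · have := (ratio_invariant h (n + 1)).2.2.2.2 h3
    exact hsm _ (by linarith)
  have h4 : |digit ξ (n + 1)| = 2 := by have := two_le_abs_digit h n; omega
  have h4' : |(digit ξ (n + 1) : ℝ)| = 2 := by exact_mod_cast h4
  rcases le_or_gt (ratio ξ n * quotient ξ (n + 1)) 0 with h5 | h5
  · have h6 := abs_digit_le_abs_sub_ratio h n h5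
    rw [h4'] at h6
    exact hsm _ (by nlinarith [abs_nonneg (ratio ξ (n + 1))])
  obtain ⟨k, hk, h6⟩ := (ratio_invariant h n).2.2.2.1 h5
  have h7 := (ratio_invariant h n).2.2.2.2 h6
  have h8 : K ≤ (den ξ (n + 1) : ℝ) ^ 2 * (lam - |ratio ξ n|) := by
    subst hk
    rcases le_sq_den_mul_lam_sub h hm (show m ≤ k + 1 by omega) h6 with h9 | h9
    · rcases hr' (k + 1) (by omega) with h10 | h10
      · omega
      · exact absurd h9 h10
    · exact h9
  refine h8.trans ?_
  rw [h2]
  rw [abs_digit_sub_ratio_of_pos h n h5, h4'] at h1 ⊢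
  set σ := |ratio ξ n|
  set τ := |ratio ξ (n + 1)|
  -- The map `σ ↦ 1 / (2 - σ)` sends `lam` to `1 - lam`; a digit `±2` thus transfers the scaled
  -- distance with net factor `(1 - lam) * (2 - σ) ≥ 1`.
  have e : (den ξ (n + 1) : ℝ) ^ 2 * (2 - σ) ^ 2 * (1 - lam - τ)
      = (den ξ (n + 1) : ℝ) ^ 2 * ((lam - σ) * ((1 - lam) * (2 - σ))) := by
    linear_combination (-(den ξ (n + 1) : ℝ) ^ 2 * (2 - σ)) * (h1 - hsq)
  rw [e]
  apply mul_le_mul_of_nonneg_left _ (sq_nonneg _)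
  apply le_mul_of_one_le_right (by linarith)
  nlinarith

/-! ### Values of the form at convergents -/

theorem form_eq {a b c d : ℝ} (hdet : a * d - b * c = 1) (hb : b ≠ 0) (x y : ℝ) :
    (a * y + b * x) * (c * y + d * x)
      = -(y * (y * (a / b) + x) - d * b * (y * (a / b) + x) ^ 2) := by
  obtain ⟨ξ, rfl⟩ : ∃ ξ, a = ξ * b := ⟨a / b, by field_simp⟩
  rw [mul_div_assoc, div_self hb]
  linear_combination (-y * (y * ξ + x)) * hdet

theorem mul_linear_form_eq {a b c d : ℝ} (hdet : a * d - b * c = 1) (hb : b ≠ 0) (x y : ℝ) :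
    b * (c * y + d * x) = d * b * (y * (a / b) + x) - y := by
  obtain ⟨ξ, rfl⟩ : ∃ ξ, a = ξ * b := ⟨a / b, by field_simp⟩
  rw [mul_div_assoc, div_self hb]
  linear_combination (-y) * hdet

/-- The reciprocal `|ξₘ - s|` of the approximation quality of the `m`-th convergent. -/
theorem abs_quotient_sub_ratio_bounds {ξ : ℝ} (h : Irrational ξ) (n : ℕ) :
    |(digit ξ (n + 1) : ℝ)| - 1 / 2 - lam ≤ |quotient ξ (n + 1) - ratio ξ n| ∧
    |quotient ξ (n + 1) - ratio ξ n| ≤ |(digit ξ (n + 1) : ℝ)| + 1 / 2 + |ratio ξ n| ∧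
    1 ≤ |quotient ξ (n + 1) - ratio ξ n| := by
  have h1 := abs_digit_sub_quotient h (n + 1)
  have h2 := two_lt_abs_quotient h n
  have h3 := abs_sub_ratio_ge h n (x := quotient ξ (n + 1))
    (mul_self_pos.2 (by intro h0; rw [h0] at h2; simp at h2; linarith))
  have h4 := abs_sub_abs_le_abs_sub (digit ξ (n + 1) : ℝ) (quotient ξ (n + 1))
  have h5 := abs_sub_abs_le_abs_sub (quotient ξ (n + 1)) (digit ξ (n + 1) : ℝ)
  rw [abs_sub_comm] at h5
  have h6 := abs_sub (quotient ξ (n + 1)) (ratio ξ n)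
  have hl := lam_lt
  exact ⟨by linarith, by linarith, by linarith⟩

theorem abs_den_mul_err_le_one {ξ : ℝ} (h : Irrational ξ) (n : ℕ) :
    |(den ξ (n + 1) : ℝ) * err ξ (n + 1)| ≤ 1 := by
  have h1 := abs_den_mul_err h n
  have h2 := (abs_quotient_sub_ratio_bounds h n).2.2
  nlinarith [abs_nonneg ((den ξ (n + 1) : ℝ) * err ξ (n + 1))]

theorem one_le_abs_den {ξ : ℝ} (h : Irrational ξ) (n : ℕ) : 1 ≤ |(den ξ (n + 1) : ℝ)| := by
  have := le_abs_den h (n + 1)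
  push_cast at this
  linarith [show (0 : ℝ) ≤ n by positivity]

theorem abs_err_le_one {ξ : ℝ} (h : Irrational ξ) (n : ℕ) : |err ξ (n + 1)| ≤ 1 := by
  have h1 := abs_den_mul_err_le_one h n
  have h2 := one_le_abs_den h n
  rw [abs_mul] at h1
  nlinarith [abs_nonneg (err ξ (n + 1))]

/-- The perturbation term of the form, scaled by the approximation quality. -/
theorem sq_den_mul_abs_sq_err_le {ξ : ℝ} (h : Irrational ξ) (n : ℕ) (D : ℝ) :
    (den ξ (n + 1) : ℝ) ^ 2 *
      (|D * err ξ (n + 1) ^ 2| * |quotient ξ (n + 1) - ratio ξ n|) ≤ |D| := by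
  have h1 := abs_den_mul_err h n
  have h2 := abs_den_mul_err_le_one h n
  set θ := |(den ξ (n + 1) : ℝ) * err ξ (n + 1)| with hθ
  have e : (den ξ (n + 1) : ℝ) ^ 2 * |D * err ξ (n + 1) ^ 2| = |D| * θ ^ 2 := by
    rw [hθ, sq_abs, mul_pow, abs_mul, abs_of_nonneg (sq_nonneg (err ξ (n + 1)))]; ring
  rw [← mul_assoc, e]
  calc |D| * θ ^ 2 * |quotient ξ (n + 1) - ratio ξ n|
      = |D| * θ * (θ * |quotient ξ (n + 1) - ratio ξ n|) := by ring
    _ = |D| * θ := by rw [h1, mul_one]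
    _ ≤ |D| := mul_le_of_le_one_right (abs_nonneg _) h2

/-- Bounding `|s|` by `1 - lam` would give this exact threshold without the quadratic term. The gap
`1 - lam - |s|`, eventually at least `|D| / β` over the squared denominator, absorbs that term. -/
theorem lt_abs_digit_of_abs_lt {ξ : ℝ} (h : Irrational ξ) (D : ℝ) {β : ℝ} (hβ : 0 < β) :
    ∃ m, ∀ n, m ≤ n →
      |den ξ (n + 1) * err ξ (n + 1) - D * err ξ (n + 1) ^ 2| < β →
        1 / β - 3 / 2 + lam < |(digit ξ (n + 1) : ℝ)| := by
  obtain ⟨m, hm⟩ := sq_den_mul_one_sub_lam_sub h (|D| / β)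
  refine ⟨m, fun n hn hlt => ?_⟩
  have h1 := hm n hn
  have h2 := sq_den_mul_abs_sq_err_le h n D
  have h3 := abs_den_mul_err h n
  obtain ⟨-, h4, h5⟩ := abs_quotient_sub_ratio_bounds h n
  have h6 := abs_sub_abs_le_abs_sub ((den ξ (n + 1) : ℝ) * err ξ (n + 1)) (D * err ξ (n + 1) ^ 2)
  have hq : 0 < (den ξ (n + 1) : ℝ) ^ 2 := by have := den_succ_ne h n; positivity
  set X := |quotient ξ (n + 1) - ratio ξ n|
  set θ := |(den ξ (n + 1) : ℝ) * err ξ (n + 1)|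
  set q2 := (den ξ (n + 1) : ℝ) ^ 2
  have h7 : 1 - |D * err ξ (n + 1) ^ 2| * X < β * X := by nlinarith
  have h8 : q2 - |D| < q2 * (β * X) := by nlinarith
  have h9 : q2 * (1 / β) < q2 * X + |D| / β := by
    have : q2 * (1 / β) - |D| / β = (q2 - |D|) / β := by ring
    have h10 : (q2 - |D|) / β < q2 * X := by rw [div_lt_iff₀ hβ]; linarith
    linarith
  have h10 : 1 / β < X + (1 - lam - |ratio ξ n|) := by
    refine lt_of_mul_lt_mul_left ?_ hq.le
    linarith
  linarith

theorem abs_lt_of_lt_abs_digit {ξ : ℝ} (h : Irrational ξ) (D : ℝ) {β : ℝ} (hβ : 0 < β) :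
    ∃ m, ∀ n, m ≤ n → 1 / β + 1 / 2 + lam < |(digit ξ (n + 1) : ℝ)| →
      |den ξ (n + 1) * err ξ (n + 1) - D * err ξ (n + 1) ^ 2| < β := by
  set T := 1 / β + 1 / 2 + lam with hT
  -- An integer exceeding `T` exceeds it by at least this gap, which does not depend on `n`; it
  -- absorbs the quadratic term once the denominator is large.
  have hg : 0 < (⌊T⌋ : ℝ) + 1 - T := by linarith [Int.lt_floor_add_one T]
  obtain ⟨m, hm⟩ := exists_nat_gt (|D| / (β * ((⌊T⌋ : ℝ) + 1 - T)))
  refine ⟨m, fun n hn hlt => ?_⟩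
  have hfl : (⌊T⌋ : ℝ) + 1 ≤ |(digit ξ (n + 1) : ℝ)| := by
    have h1 : T < ((|digit ξ (n + 1)| : ℤ) : ℝ) := by push_cast; exact hlt
    have h2 := Int.floor_lt.2 h1
    exact_mod_cast h2
  have hq1 : (m : ℝ) ≤ (den ξ (n + 1) : ℝ) ^ 2 := by
    have h1 := le_abs_den h (n + 1)
    have h2 := one_le_abs_den h n
    have h3 : (m : ℝ) ≤ (n + 1 : ℕ) := by exact_mod_cast (by omega : m ≤ n + 1)
    rw [← sq_abs]; nlinarith
  have h2 := sq_den_mul_abs_sq_err_le h n D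
  have h3 := abs_den_mul_err h n
  obtain ⟨h4, -, h5⟩ := abs_quotient_sub_ratio_bounds h n
  have h6 := abs_sub ((den ξ (n + 1) : ℝ) * err ξ (n + 1)) (D * err ξ (n + 1) ^ 2)
  have hq : 0 < (den ξ (n + 1) : ℝ) ^ 2 := by have := den_succ_ne h n; positivity
  rw [div_lt_iff₀ (by positivity)] at hm
  set X := |quotient ξ (n + 1) - ratio ξ n|
  set θ := |(den ξ (n + 1) : ℝ) * err ξ (n + 1)|
  set q2 := (den ξ (n + 1) : ℝ) ^ 2
  set g := (⌊T⌋ : ℝ) + 1 - T with hgdef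
  have h7 : |D * err ξ (n + 1) ^ 2| * X < β * g := by
    refine lt_of_mul_lt_mul_left ?_ hq.le
    have := mul_le_mul_of_nonneg_right hq1 (by positivity : 0 ≤ β * g)
    linarith
  have h8 : 1 / β + g ≤ X := by linarith
  have h9 : 1 + β * g ≤ β * X := by
    have := mul_le_mul_of_nonneg_left h8 hβ.le
    rwa [mul_add, mul_one_div_cancel hβ.ne'] at this
  refine lt_of_mul_lt_mul_right ?_ (by linarith : 0 ≤ X)
  have := mul_le_mul_of_nonneg_right h6 (by linarith : 0 ≤ X)
  linarith

/-! ### Points of `G` and large digits -/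

theorem norm_pair_le (x y : ℝ) : ‖!₂[x, y]‖ ≤ |x| + |y| := by
  rw [EuclideanSpace.norm_eq]
  refine Real.sqrt_le_iff.2 ⟨by positivity, ?_⟩
  simp only [Fin.sum_univ_two, Real.norm_eq_abs]
  simp only [Matrix.cons_val_zero, Matrix.cons_val_one]
  nlinarith [mul_nonneg (abs_nonneg x) (abs_nonneg y)]

theorem gcd_num_den (ξ : ℝ) (n : ℕ) : Int.gcd (num ξ n) (den ξ n) = 1 := by
  rw [← Int.isCoprime_iff_gcd_eq_one]
  refine ⟨den ξ (n + 1), -num ξ (n + 1), ?_⟩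
  have := num_mul_den ξ n
  linarith

/-- Large digits produce elements of `G`. -/
theorem exists_mem_G {a b c d : ℝ} (hdet : a * d - b * c = 1) (hb : b ≠ 0)
    (hirr : Irrational (a / b)) {δ : ℝ} (κ : ℝ) (hδ : 0 < δ) :
    ∃ (m : ℕ) (C : ℝ), 0 < C ∧ ∀ n, m ≤ n →
      2 / δ ^ 2 + 1 / 2 + lam < |(digit (a / b) (n + 1) : ℝ)| →
      ∃ z : ℤ × ℤ, |z.2| = |den (a / b) (n + 1)| ∧
        ∀ ρ, C * |(den (a / b) (n + 1) : ℝ)| ≤ ρ → z ∈ G a b c d δ κ ρ := by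
  set ξ := a / b with hξ
  have hβ : 0 < δ ^ 2 / 2 := by positivity
  obtain ⟨m1, hm1⟩ := abs_lt_of_lt_abs_digit hirr (d * b) hβ
  obtain ⟨m2, hm2⟩ := exists_nat_gt (|d * b| + |b| * |κ|)
  refine ⟨max m1 m2, |ξ| + 2, by positivity, fun n hn hlt => ?_⟩
  have hQ := hm1 n (le_of_max_le_left hn) (by rwa [one_div_div])
  have hL := abs_err_le_one hirr n
  have hL0 := err_ne_zero hirr (n + 1)
  have hq1 := one_le_abs_den hirr n
  have hqm : |d * b| + |b| * |κ| < |(den ξ (n + 1) : ℝ)| := by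
    have h1 := le_abs_den hirr (n + 1)
    have h2 : (m2 : ℝ) ≤ (n + 1 : ℕ) := by
      exact_mod_cast (le_of_max_le_right hn).trans (Nat.le_succ n)
    linarith
  have hLdef : (den ξ (n + 1) : ℝ) * ξ + -num ξ (n + 1) = err ξ (n + 1) := by
    simp only [err]; ring
  have hP : |(num ξ (n + 1) : ℝ)| ≤ (|ξ| + 1) * |(den ξ (n + 1) : ℝ)| := by
    have h1 : (num ξ (n + 1) : ℝ) = den ξ (n + 1) * ξ - err ξ (n + 1) := by
      simp only [err]; ring
    have h2 := abs_sub ((den ξ (n + 1) : ℝ) * ξ) (err ξ (n + 1))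
    rw [← h1, abs_mul] at h2
    linarith
  have hgcd := gcd_num_den ξ (n + 1)
  set q := den ξ (n + 1)
  set p := num ξ (n + 1)
  set v := c * q + d * -p with hv
  have hbv : b * v = d * b * err ξ (n + 1) - q := by
    rw [hv, mul_linear_form_eq hdet hb, ← hξ, hLdef]
  have hvabs : |κ| < |v| := by
    have h1 : |(q : ℝ)| ≤ |b| * |v| + |d * b| := by
      have h2 : (q : ℝ) = d * b * err ξ (n + 1) - b * v := by linarith
      have h3 := abs_sub (d * b * err ξ (n + 1)) (b * v)
      rw [← h2, abs_mul (d * b), abs_mul b v] at h3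
      have := mul_le_of_le_one_right (abs_nonneg (d * b)) hL
      linarith
    refine lt_of_mul_lt_mul_left ?_ (abs_nonneg b)
    linarith
  have hform : (a * q + b * -p) * v = -(q * err ξ (n + 1) - d * b * err ξ (n + 1) ^ 2) := by
    rw [hv, form_eq hdet hb, ← hξ, hLdef]
  have hpos : 0 < |(a * q + b * -p) * v| := by
    have h1 : (a * q + b * -p) = b * err ξ (n + 1) := by
      rw [← hLdef, hξ]; field_simp
    have hv0 : v ≠ 0 := by
      intro h0; rw [h0, abs_zero] at hvabs; exact absurd (abs_nonneg κ) (not_le.2 hvabs)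
    rw [h1]; positivity
  have hlt' : |(a * q + b * -p) * v| < δ ^ 2 / 2 := by rw [hform, abs_neg]; exact hQ
  have hnorm : |(p : ℝ)| + |(q : ℝ)| ≤ (|ξ| + 2) * |(q : ℝ)| := by linarith
  -- Both signs of the vector give the same value of the form; take the one on which `c y + d x` is
  -- positive.
  rcases le_or_gt 0 v with hv0 | hv0
  · refine ⟨(-p, q), rfl, fun ρ hρ => ⟨?_, ?_, ?_, ?_, ?_⟩⟩
    · simpa using hgcd
    · push_cast; exact hpos
    · push_cast; exact hlt'
    · push_cast; rw [abs_of_nonneg hv0] at hvabs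
      exact (le_abs_self κ).trans_lt hvabs
    · refine (norm_pair_le _ _).trans ?_
      push_cast; rw [abs_neg]; linarith
  · have e : (a * -(q : ℝ) + b * p) * (c * -(q : ℝ) + d * p) = (a * q + b * -p) * v := by
      rw [hv]; ring
    refine ⟨(p, -q), abs_neg q, fun ρ hρ => ⟨?_, ?_, ?_, ?_, ?_⟩⟩
    · simpa using hgcd
    · push_cast; rw [e]; exact hpos
    · push_cast; rw [e]; exact hlt'
    · push_cast; rw [abs_of_neg hv0] at hvabs
      refine (le_abs_self κ).trans_lt (hvabs.trans_eq ?_)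
      rw [hv]; ring
    · refine (norm_pair_le _ _).trans ?_
      push_cast; rw [abs_neg]; linarith

theorem abs_linear_form_lt {a b c d δ κ ρ : ℝ} (hκ : 0 < κ) {z : ℤ × ℤ}
    (hz : z ∈ G a b c d δ κ ρ) : |a * z.2 + b * z.1| < δ ^ 2 / 2 / κ := by
  obtain ⟨-, -, h3, h4, -⟩ := hz
  rw [abs_mul, abs_of_pos (hκ.trans h4)] at h3
  rw [lt_div_iff₀ hκ]
  nlinarith [abs_nonneg (a * (z.2 : ℝ) + b * z.1)]

/-- Elements of `G` of bounded height lie in a finite set that does not depend on `ρ`. -/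
theorem exists_finite_of_abs_lt {a b c d δ κ : ℝ} (hb : b ≠ 0) (hκ : 0 < κ) (Y : ℤ) :
    ∃ F : Finset (ℤ × ℤ), ∀ ρ, ∀ z ∈ G a b c d δ κ ρ, |z.2| < Y → z ∈ F := by
  set X : ℤ := ⌈(δ ^ 2 / 2 / κ + |a| * Y) / |b|⌉ with hX
  refine ⟨Finset.Icc (-X) X ×ˢ Finset.Icc (-Y) Y, fun ρ z hz hY => ?_⟩
  have h1 := abs_linear_form_lt hκ hz
  have h2 : |b| * |(z.1 : ℝ)| ≤ δ ^ 2 / 2 / κ + |a| * Y := by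
    have h3 : |(z.2 : ℝ)| ≤ Y := by exact_mod_cast hY.le
    have h4 := abs_sub (a * z.2 + b * z.1) (a * z.2)
    rw [add_sub_cancel_left, abs_mul b, abs_mul a] at h4
    have := mul_le_mul_of_nonneg_left h3 (abs_nonneg a)
    linarith
  have h3 : |z.1| ≤ X := by
    have : |(z.1 : ℝ)| ≤ X := by
      refine le_trans ?_ (Int.le_ceil _)
      rw [le_div_iff₀ (abs_pos.2 hb)]; linarith
    exact_mod_cast this
  rw [Finset.mem_product, Finset.mem_Icc, Finset.mem_Icc]
  exact ⟨abs_le.1 h3, abs_le.1 hY.le⟩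

/-- Elements of `G` of large height come from convergents with a large digit. -/
theorem exists_convergent_of_mem_G {a b c d : ℝ} (hdet : a * d - b * c = 1) (hb : b ≠ 0)
    (hirr : Irrational (a / b)) {δ κ : ℝ} (hδ : 0 < δ) (hδ' : δ ^ 2 / 2 < 0.38) (hκ : 0 < κ) :
    ∃ Y : ℤ, ∀ ρ, ∀ z ∈ G a b c d δ κ ρ, Y ≤ |z.2| → ∃ m,
      2 / δ ^ 2 - 3 / 2 + lam < |(digit (a / b) m : ℝ)| ∧
      |(den (a / b) m : ℝ)| ≤ ρ ∧
      (z = (-num (a / b) m, den (a / b) m) ∨ z = (num (a / b) m, -den (a / b) m)) := by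
  set ξ := a / b with hξ
  set β := δ ^ 2 / 2 with hβdef
  have hβ : 0 < β := by positivity
  obtain ⟨m, hm⟩ := lt_abs_digit_of_abs_lt hirr (d * b) hβ
  set U := β / κ with hU
  have hU0 : 0 < U := by positivity
  have hgap : 0 < 0.38 - β := by linarith
  -- Chosen so that `|u| * R ≤ 1` forces the quadratic term `d / b * u ^ 2` below `0.38 - β`. A
  -- large `|y|` makes `|v| ≥ β * R`, and then `|u| * |v| < β` yields this.
  set R := 1 + |d / b| / (0.38 - β) with hR
  have hR1 : 1 ≤ R := by rw [hR]; linarith [div_nonneg (abs_nonneg (d / b)) hgap.le]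
  refine ⟨max (max ⌈|d| * U + |b| * (β * R)⌉ |den ξ (m + 1)|) 1, fun ρ z hz hY => ?_⟩
  obtain ⟨⟨hY1, hY2⟩, hY3⟩ := (by simpa only [max_le_iff] using hY :
    (⌈|d| * U + |b| * (β * R)⌉ ≤ |z.2| ∧ |den ξ (m + 1)| ≤ |z.2|) ∧ 1 ≤ |z.2|)
  have hu := abs_linear_form_lt hκ hz
  obtain ⟨hgcd, -, hlt, -, hnorm⟩ := hz
  obtain ⟨x, y⟩ := z
  simp only at hY1 hY2 hY3 hu hgcd hlt hnorm ⊢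
  have hy : |d| * U + |b| * (β * R) ≤ |(y : ℝ)| := by
    refine (Int.le_ceil _).trans ?_
    exact_mod_cast hY1
  have hbv := mul_linear_form_eq hdet hb x y
  have hL : (a * y + b * x) = b * (y * ξ + x) := by rw [hξ]; field_simp
  have hform := form_eq hdet hb x y
  rw [← hξ] at hbv hform
  set L := y * ξ + x with hLdef
  set u := a * y + b * x
  set v := c * y + d * x
  have hb0 := abs_pos.2 hb
  have huR : |u| * R ≤ 1 := by
    have h1 : |(y : ℝ)| ≤ |d| * |u| + |b| * |v| := by
      have h2 : (y : ℝ) = d * u - b * v := by rw [hbv, hL]; ring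
      rw [h2, ← abs_mul, ← abs_mul]
      exact abs_sub _ _
    have h2 : |d| * |u| ≤ |d| * U := mul_le_mul_of_nonneg_left hu.le (abs_nonneg d)
    have h3 : β * R ≤ |v| := by
      refine le_of_mul_le_mul_left ?_ hb0
      linarith
    have h4 : |u| * |v| < β := by rw [← abs_mul]; exact hlt
    have h5 := mul_le_mul_of_nonneg_left h3 (abs_nonneg u)
    refine le_of_mul_le_mul_left ?_ hβ
    linarith
  have hDL : |d * b * L ^ 2| < 0.38 - β := by
    have h1 : d * b * L ^ 2 = d / b * u ^ 2 := by rw [hL]; field_simp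
    have h2 : |d / b| < R * (0.38 - β) := by
      rw [hR, add_mul, div_mul_cancel₀ _ hgap.ne']; linarith
    rw [h1, abs_mul, abs_of_nonneg (sq_nonneg u), ← sq_abs u]
    have h3 : |u| ≤ 1 := by nlinarith [abs_nonneg u]
    rcases (abs_nonneg u).eq_or_lt with h4 | h4
    · rw [← h4]; simpa using hgap
    · calc |d / b| * |u| ^ 2 < R * (0.38 - β) * |u| ^ 2 :=
            mul_lt_mul_of_pos_right h2 (by positivity)
        _ = (|u| * R) * |u| * (0.38 - β) := by ring
        _ ≤ 1 * 1 * (0.38 - β) := by gcongr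
        _ = 0.38 - β := by ring
  rw [hform, abs_neg] at hlt
  have hyL : |(y : ℝ) * L| < lam := by
    have := abs_sub_abs_le_abs_sub ((y : ℝ) * L) (d * b * L ^ 2)
    have := lam_gt
    linarith
  have hy0 : y ≠ 0 := by intro h0; rw [h0] at hY3; simp at hY3
  have hnormy : |(y : ℝ)| ≤ ρ := (PiLp.norm_apply_le !₂[(x : ℝ), (y : ℝ)] 1).trans hnorm
  obtain ⟨n, hn⟩ := eq_convergent hirr (p := -x) (q := y) (by simpa using hgcd) hy0
    (by push_cast; rw [sub_neg_eq_add]; exact hyL)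
  have hden : |y| = |den ξ (n + 1)| := by
    rcases hn with ⟨-, h1⟩ | ⟨-, h1⟩
    · rw [h1]
    · rw [h1, abs_neg]
  have hmn : m ≤ n := by
    rw [hden] at hY2
    have := (abs_den_strictMono hirr).le_iff_le.1 hY2
    omega
  have hdenr : |(den ξ (n + 1) : ℝ)| = |(y : ℝ)| := by exact_mod_cast hden.symm
  have hlt' : |den ξ (n + 1) * err ξ (n + 1) - d * b * err ξ (n + 1) ^ 2| < β := by
    rcases hn with ⟨h1, h2⟩ | ⟨h1, h2⟩
    · have e : err ξ (n + 1) = L := by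
        rw [err, ← h1, ← h2, hLdef]; push_cast; ring
      rw [e, ← h2]; exact hlt
    · have e : err ξ (n + 1) = -L := by
        have h1' : num ξ (n + 1) = x := by linarith
        have h2' : den ξ (n + 1) = -y := by linarith
        rw [err, h1', h2', hLdef]; push_cast; ring
      have h2' : (den ξ (n + 1) : ℝ) = -y := by rw [h2]; push_cast; ring
      rw [e, h2', neg_mul_neg, neg_sq]; exact hlt
  refine ⟨n + 1, ?_, by rw [hdenr]; exact hnormy, ?_⟩
  · have := hm n hmn hlt'
    rwa [hβdef, one_div_div] at this
  · rcases hn with ⟨h1, h2⟩ | ⟨h1, h2⟩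
    · left; rw [← h2, ← h1]; simp
    · right; rw [h2]; simp; linarith

/-! ### Consequences of the limits -/

theorem alphaSum_nonneg (ξ : ℝ) (n : ℕ) : 0 ≤ alphaSum ξ n :=
  Finset.sum_nonneg fun j _ => by rw [Real.log_abs]; exact Real.log_intCast_nonneg _

theorem alphaPlus_nonneg (ξ : ℝ) : 0 ≤ alphaPlus ξ := by
  refine le_limsup_of_frequently_le (Frequently.of_forall fun n => ?_)
  exact EReal.coe_nonneg.2 (div_nonneg (alphaSum_nonneg ξ n) n.cast_nonneg)

theorem eventually_alphaSum_le {ξ : ℝ} (h : alphaPlus ξ < ⊤) {τ : ℝ} (hτ : 0 < τ) :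
    ∀ᶠ n : ℕ in atTop, alphaSum ξ n ≤ ((alphaPlus ξ).toReal + τ) * n := by
  have h1 : limsup (fun n : ℕ => ((alphaSum ξ n / n : ℝ) : EReal)) atTop
      < (((alphaPlus ξ).toReal + τ : ℝ) : EReal) := by
    have h2 := EReal.coe_toReal h.ne ((EReal.bot_lt_zero.trans_le (alphaPlus_nonneg ξ)).ne')
    calc alphaPlus ξ = ((alphaPlus ξ).toReal : EReal) := h2.symm
      _ < _ := EReal.coe_lt_coe_iff.2 (by linarith)
  filter_upwards [eventually_lt_of_limsup_lt h1, eventually_gt_atTop 0] with n hn hn0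
  have hn' : (0 : ℝ) < n := by exact_mod_cast hn0
  have := EReal.coe_lt_coe_iff.1 hn
  rw [div_lt_iff₀ hn'] at this
  exact this.le

theorem eventually_lt_of_le_liminf {g : ℕ → ℝ} {M M' : ℝ}
    (hM : (M : EReal) ≤ liminf (fun n : ℕ => ((g n / n : ℝ) : EReal)) atTop) (hM' : M' < M) :
    ∀ᶠ n : ℕ in atTop, M' * n < g n := by
  have h1 : (M' : EReal) < liminf (fun n : ℕ => ((g n / n : ℝ) : EReal)) atTop :=
    (EReal.coe_lt_coe_iff.2 hM').trans_le hM
  filter_upwards [eventually_lt_of_lt_liminf h1, eventually_gt_atTop 0] with n hn hn0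
  have hn' : (0 : ℝ) < n := by exact_mod_cast hn0
  have := EReal.coe_lt_coe_iff.1 hn
  rwa [lt_div_iff₀ hn'] at this

theorem eventually_lt_eta_mul_alphaSum {ξ M M' : ℝ}
    (hM : (M : EReal) ≤ (eta : EReal) * alphaMinus ξ) (hM' : M' < M) :
    ∀ᶠ n : ℕ in atTop, M' * n < eta * alphaSum ξ n := by
  have h0 := eta_pos
  have h1 : ((M' / eta : ℝ) : EReal) < alphaMinus ξ := by
    by_contra! h2
    have h3 : (eta : EReal) * alphaMinus ξ ≤ (eta : EReal) * ((M' / eta : ℝ) : EReal) :=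
      mul_le_mul_of_nonneg_left h2 (EReal.coe_nonneg.2 h0.le)
    rw [← EReal.coe_mul, mul_div_cancel₀ _ h0.ne'] at h3
    exact absurd (EReal.coe_le_coe_iff.1 (hM.trans h3)) (not_le.2 hM')
  -- A real number in between also covers `alphaMinus ξ = ⊤`.
  obtain ⟨r, hr1, hr2⟩ := EReal.lt_iff_exists_real_btwn.1 h1
  filter_upwards [eventually_lt_of_le_liminf hr2.le (EReal.coe_lt_coe_iff.1 hr1)] with n hn
  have := mul_lt_mul_of_pos_left hn h0
  rwa [← mul_assoc, mul_div_cancel₀ _ h0.ne'] at this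

/-- A slope strictly between `M'` and `M` leaves a linear surplus that swallows the constant. -/
theorem eventually_le_log_den {ξ M M' : ℝ} {g : ℕ → ℝ}
    (hg : ∃ C, ∀ n, g (n + 1) ≤ Real.log |(den ξ (n + 1) : ℝ)| + C)
    (hM : ∀ M' < M, ∀ᶠ n : ℕ in atTop, M' * n < g n) (hM' : M' < M) :
    ∀ᶠ n : ℕ in atTop, M' * n ≤ Real.log |(den ξ n : ℝ)| := by
  obtain ⟨C, hC⟩ := hg
  obtain ⟨r, hr1, hr2⟩ := exists_between hM'
  have h1 : ∀ᶠ n : ℕ in atTop, C / (r - M') ≤ n :=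
    tendsto_natCast_atTop_atTop.eventually_ge_atTop _
  filter_upwards [hM r hr2, h1, eventually_gt_atTop 0] with n hn hn1 hn0
  obtain ⟨k, rfl⟩ : ∃ k, n = k + 1 := ⟨n - 1, by omega⟩
  have := hC k
  rw [div_le_iff₀ (by linarith)] at hn1
  nlinarith

theorem card_div_mem_Icc (p : ℕ → Prop) [DecidablePred p] (n : ℕ) :
    (({i ∈ Finset.range n | p i}.card : ℝ) / n) ∈ Set.Icc 0 1 := by
  refine ⟨by positivity, div_le_one_of_le₀ ?_ n.cast_nonneg⟩
  have := Finset.card_filter_le (Finset.range n) p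
  rw [Finset.card_range] at this
  exact_mod_cast this

theorem eventually_lt_eCount {ξ δ r : ℝ} (hr : r < eMinus ξ δ) :
    ∀ᶠ n : ℕ in atTop, r * n < eCount ξ δ n := by
  have h1 : ∀ᶠ n : ℕ in atTop, r < (eCount ξ δ n : ℝ) / n :=
    eventually_lt_of_lt_liminf hr
      (isBoundedUnder_of ⟨0, fun n => (card_div_mem_Icc _ n).1⟩)
  filter_upwards [h1, eventually_gt_atTop 0] with n hn hn0
  rwa [lt_div_iff₀ (by exact_mod_cast hn0)] at hn

theorem eventually_fCount_lt {ξ δ r : ℝ} (hr : fPlus ξ δ < r) :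
    ∀ᶠ n : ℕ in atTop, fCount ξ δ n < r * n := by
  have h1 : ∀ᶠ n : ℕ in atTop, (fCount ξ δ n : ℝ) / n < r :=
    eventually_lt_of_limsup_lt hr
      (isBoundedUnder_of ⟨1, fun n => (card_div_mem_Icc _ n).2⟩)
  filter_upwards [h1, eventually_gt_atTop 0] with n hn hn0
  rwa [div_lt_iff₀ (by exact_mod_cast hn0)] at hn

theorem fPlus_nonneg (ξ δ : ℝ) : 0 ≤ fPlus ξ δ :=
  le_limsup_of_frequently_le (Frequently.of_forall fun n => (card_div_mem_Icc _ n).1)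
    (isBoundedUnder_of ⟨1, fun n => (card_div_mem_Icc _ n).2⟩)

/-! ### Counting -/

/-- Comparison of `G` with the large digits, from below. -/
theorem eCount_le_ncard_G {a b c d : ℝ} (hdet : a * d - b * c = 1) (hb : b ≠ 0)
    (hirr : Irrational (a / b)) {δ : ℝ} (κ : ℝ) (hδ : 0 < δ) :
    ∃ (m : ℕ) (C : ℝ), 0 < C ∧ ∀ N ρ, C * |(den (a / b) N : ℝ)| ≤ ρ →
      (eCount (a / b) δ N : ℝ) ≤ (G a b c d δ κ ρ).ncard + m := by
  obtain ⟨m, C, hC, hz⟩ := exists_mem_G (c := c) (d := d) hdet hb hirr κ hδ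
  refine ⟨m + 1, C, hC, fun N ρ hρ => ?_⟩
  set ξ := a / b
  choose! f hf1 hf2 using hz
  set S := {i ∈ Finset.range N | 2 / δ ^ 2 + 1 / 2 + lam < |(digit ξ i : ℝ)|} with hS
  have hmem : ∀ i ∈ S \ Finset.range (m + 1), ∃ k, i = k + 1 ∧ m ≤ k ∧
      2 / δ ^ 2 + 1 / 2 + lam < |(digit ξ (k + 1) : ℝ)| ∧ k + 1 < N := by
    intro i hi
    rw [Finset.mem_sdiff, hS, Finset.mem_filter, Finset.mem_range, Finset.mem_range] at hi
    obtain ⟨k, rfl⟩ : ∃ k, i = k + 1 := ⟨i - 1, by omega⟩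
    exact ⟨k, rfl, by omega, hi.1.2, hi.1.1⟩
  have h1 : ((S \ Finset.range (m + 1)).image fun i => f (i - 1)).card
      = (S \ Finset.range (m + 1)).card := by
    refine Finset.card_image_of_injOn fun i hi j hj hij => ?_
    obtain ⟨k, rfl, hk, hk', -⟩ := hmem i hi
    obtain ⟨l, rfl, hl, hl', -⟩ := hmem j hj
    simp only [Nat.add_sub_cancel] at hij
    have h2 := hf1 k hk hk'
    rw [hij, hf1 l hl hl'] at h2
    exact ((abs_den_strictMono hirr).injective h2).symm
  have h2 : (↑((S \ Finset.range (m + 1)).image fun i => f (i - 1)) : Set (ℤ × ℤ))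
      ⊆ G a b c d δ κ ρ := by
    intro z hz
    rw [Finset.mem_coe, Finset.mem_image] at hz
    obtain ⟨i, hi, rfl⟩ := hz
    obtain ⟨k, rfl, hk, hk', hkN⟩ := hmem i hi
    simp only [Nat.add_sub_cancel]
    refine hf2 k hk hk' ρ (le_trans ?_ hρ)
    have h3 := (abs_den_strictMono hirr).monotone hkN.le
    have h4 : |(den ξ (k + 1) : ℝ)| ≤ |(den ξ N : ℝ)| := by exact_mod_cast h3
    gcongr
  have h3 := Set.ncard_le_ncard h2 (G_finite a b c d δ κ ρ)
  rw [Set.ncard_coe_finset, h1] at h3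
  have h4 := Finset.le_card_sdiff (Finset.range (m + 1)) S
  rw [Finset.card_range] at h4
  have h5 : eCount ξ δ N ≤ (G a b c d δ κ ρ).ncard + (m + 1) := by
    change S.card ≤ _; omega
  exact_mod_cast h5

/-- Comparison of `G` with the large digits, from above. -/
theorem ncard_G_le_fCount {a b c d : ℝ} (hdet : a * d - b * c = 1) (hb : b ≠ 0)
    (hirr : Irrational (a / b)) {δ κ : ℝ} (hδ : 0 < δ) (hδ' : δ ^ 2 / 2 < 0.38) (hκ : 0 < κ) :
    ∃ C : ℕ, ∀ (N : ℕ) ρ, (∀ m, |(den (a / b) m : ℝ)| ≤ ρ → m < N) →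
      ((G a b c d δ κ ρ).ncard : ℝ) ≤ fCount (a / b) δ N + C := by
  classical
  obtain ⟨Y, hY⟩ := exists_convergent_of_mem_G hdet hb hirr hδ hδ' hκ
  obtain ⟨F, hF⟩ := exists_finite_of_abs_lt (a := a) (c := c) (d := d) (δ := δ) hb hκ Y
  refine ⟨F.card, fun N ρ hN => ?_⟩
  set ξ := a / b
  set S := {i ∈ Finset.range N | 2 / δ ^ 2 - 3 / 2 + lam < |(digit ξ i : ℝ)|} with hS
  -- Since `κ > 0`, at most one of the two opposite vectors lies in `G`, so the index alone
  -- determines the point.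
  let g : ℕ → ℤ × ℤ := fun m =>
    if κ < c * den ξ m + d * -num ξ m then (-num ξ m, den ξ m) else (num ξ m, -den ξ m)
  have h1 : G a b c d δ κ ρ ⊆ ↑(S.image g ∪ F) := by
    intro z hz
    rw [Finset.coe_union]
    rcases lt_or_ge |z.2| Y with h2 | h2
    · exact Or.inr (hF ρ z hz h2)
    · left
      obtain ⟨m, hm1, hm2, hm3⟩ := hY ρ z hz h2
      rw [Finset.coe_image]
      refine ⟨m, ?_, ?_⟩
      · rw [hS, Finset.mem_coe, Finset.mem_filter, Finset.mem_range]
        exact ⟨hN m hm2, hm1⟩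
      · have h3 := hz.2.2.2.1
        rcases hm3 with h4 | h4
        · subst h4
          push_cast at h3
          exact if_pos h3
        · subst h4
          push_cast at h3
          exact if_neg (by linarith)
  have h2 := Set.ncard_le_ncard h1 (Finset.finite_toSet _)
  rw [Set.ncard_coe_finset] at h2
  have h3 : (G a b c d δ κ ρ).ncard ≤ fCount ξ δ N + F.card :=
    h2.trans ((Finset.card_union_le _ _).trans (Nat.add_le_add_right Finset.card_image_le _))
  exact_mod_cast h3

theorem ncard_G_ge {a b c d : ℝ} (hdet : a * d - b * c = 1) (hb : b ≠ 0)
    (hirr : Irrational (a / b)) {δ κ ε : ℝ} (hδ : 0 < δ) (hε : 0 < ε)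
    (hα : alphaPlus (a / b) < ⊤) :
    ∃ ρ₀ : ℝ, ∀ ρ : ℝ, ρ₀ ≤ ρ →
      (1 - ε) * (eMinus (a / b) δ / ((alphaPlus (a / b)).toReal + c0)) * Real.log ρ ≤
        ((G a b c d δ κ ρ).ncard : ℝ) := by
  obtain ⟨m, C, hC, hcount⟩ := eCount_le_ncard_G (c := c) (d := d) hdet hb hirr κ hδ
  set ξ := a / b
  set α := (alphaPlus ξ).toReal
  set e := eMinus ξ δ
  have hα0 : 0 ≤ α := EReal.toReal_nonneg (alphaPlus_nonneg ξ)
  have hc0 := log_two_lt_c0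
  have hlog2 : 0 < Real.log 2 := Real.log_pos (by norm_num)
  have hA : 0 < α + c0 := by linarith
  by_cases htriv : (1 - ε) * (e / (α + c0)) ≤ 0
  · refine ⟨1, fun ρ hρ => ?_⟩
    exact (mul_nonpos_of_nonpos_of_nonneg htriv (Real.log_nonneg hρ)).trans (Nat.cast_nonneg _)
  have he : 0 < e := by
    by_contra! h1
    have h0 : 0 ≤ e := le_liminf_of_le (isCoboundedUnder_ge_of_le _
      fun n => (card_div_mem_Icc _ n).2) (Eventually.of_forall fun n => (card_div_mem_Icc _ n).1)
    rw [le_antisymm h1 h0] at htriv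
    simp at htriv
  -- The slack in `log 2 < c0` is halved: one half for the limsup defining `alphaPlus`, the other
  -- for `log C`.
  have hτ : 0 < (c0 - Real.log 2) / 2 := by linarith
  have hden : ∀ᶠ N : ℕ in atTop, Real.log C + Real.log |(den ξ N : ℝ)| ≤ (α + c0) * N := by
    have h1 : ∀ᶠ n : ℕ in atTop, Real.log C / ((c0 - Real.log 2) / 2) ≤ n :=
      tendsto_natCast_atTop_atTop.eventually_ge_atTop _
    filter_upwards [eventually_alphaSum_le hα hτ, h1, eventually_gt_atTop 0] with N h2 h3 h4
    obtain ⟨k, rfl⟩ : ∃ k, N = k + 1 := ⟨N - 1, by omega⟩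
    have h5 := log_den_le hirr k
    rw [div_le_iff₀ hτ] at h3
    push_cast at *
    nlinarith
  have hr : (1 - ε / 2) * e < e := by nlinarith
  have hev : ∀ᶠ N : ℕ in atTop, C * |(den ξ N : ℝ)| ≤ Real.exp ((α + c0) * N) ∧
      (1 - ε / 2) * e * N < eCount ξ δ N := by
    filter_upwards [hden, eventually_lt_eCount hr, eventually_gt_atTop 0] with N h1 h2 h3
    refine ⟨?_, h2⟩
    obtain ⟨k, rfl⟩ : ∃ k, N = k + 1 := ⟨N - 1, by omega⟩
    have h4 := abs_pos.2 (den_succ_ne hirr k)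
    rw [← Real.log_mul hC.ne' h4.ne'] at h1
    rw [← Real.exp_log (mul_pos hC h4)]
    exact Real.exp_le_exp.2 h1
  have hN : Tendsto (fun ρ : ℝ => ⌊Real.log ρ / (α + c0)⌋₊) atTop atTop :=
    tendsto_nat_floor_atTop.comp (Real.tendsto_log_atTop.atTop_div_const hA)
  have hlarge : ∀ᶠ ρ : ℝ in atTop,
      (m + |(1 - ε / 2) * e|) * (α + c0) / (ε / 2 * e) ≤ Real.log ρ :=
    Real.tendsto_log_atTop.eventually_ge_atTop _
  obtain ⟨ρ₀, hρ₀⟩ := eventually_atTop.1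
    ((hN.eventually hev).and (hlarge.and (eventually_ge_atTop (1 : ℝ))))
  refine ⟨ρ₀, fun ρ hρ => ?_⟩
  obtain ⟨⟨h1, h2⟩, h3, h4⟩ := hρ₀ ρ hρ
  set N := ⌊Real.log ρ / (α + c0)⌋₊
  have hlog : 0 ≤ Real.log ρ := Real.log_nonneg h4
  have hN1 : (N : ℝ) ≤ Real.log ρ / (α + c0) := Nat.floor_le (div_nonneg hlog hA.le)
  have hN2 : Real.log ρ / (α + c0) < N + 1 := Nat.lt_floor_add_one _
  have h5 := hcount N ρ (h1.trans (by
    rw [← Real.exp_log (show 0 < ρ by linarith)]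
    apply Real.exp_le_exp.2
    rw [le_div_iff₀ hA] at hN1
    linarith))
  have hε1 : 0 ≤ 1 - ε := by
    by_contra! h6
    exact htriv (mul_nonpos_of_nonpos_of_nonneg h6.le (div_nonneg he.le hA.le))
  rw [div_le_iff₀ (by positivity)] at h3
  have h6 : m + |(1 - ε / 2) * e| ≤ ε / 2 * e * (Real.log ρ / (α + c0)) := by
    rw [← mul_div_assoc, le_div_iff₀ hA]; linarith
  have h7 : (1 - ε) * (e / (α + c0)) * Real.log ρ = (1 - ε) * e * (Real.log ρ / (α + c0)) := by
    ring
  have h8 := le_abs_self ((1 - ε / 2) * e)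
  have h9 : 0 ≤ (1 - ε / 2) * e := mul_nonneg (by linarith) he.le
  rw [h7]
  nlinarith

theorem ncard_G_le {a b c d : ℝ} (hdet : a * d - b * c = 1) (hb : b ≠ 0)
    (hirr : Irrational (a / b)) {δ κ ε M : ℝ} (hδ : 0 < δ) (hδ' : δ ^ 2 / 2 < 0.38) (hκ : 0 < κ)
    (hε : 0 < ε) (hM : 0 < M)
    (hgrow : ∀ M' < M, ∀ᶠ n : ℕ in atTop, M' * n ≤ Real.log |(den (a / b) n : ℝ)|) :
    ∃ ρ₀ : ℝ, ∀ ρ : ℝ, ρ₀ ≤ ρ →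
      ((G a b c d δ κ ρ).ncard : ℝ) ≤
        (1 + ε) * ((fPlus (a / b) δ + ε) / M) * Real.log ρ := by
  obtain ⟨C, hC⟩ := ncard_G_le_fCount (c := c) (d := d) hdet hb hirr hδ hδ' hκ
  set ξ := a / b
  set f := fPlus ξ δ
  have hf := fPlus_nonneg ξ δ
  -- The factor `1 + ε` pays for growth at a rate strictly below `M`; the summand `ε` is shared
  -- between the limsup and the additive constants.
  set M' := M / (1 + ε) with hM'
  have hM'0 : 0 < M' := by positivity
  obtain ⟨n₀, hn₀⟩ := eventually_atTop.1 (hgrow M' (div_lt_self hM (by linarith)))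
  have hN : Tendsto (fun ρ : ℝ => ⌊Real.log ρ / M'⌋₊ + 1) atTop atTop :=
    (tendsto_add_atTop_nat 1).comp
      (tendsto_nat_floor_atTop.comp (Real.tendsto_log_atTop.atTop_div_const hM'0))
  have hlarge : ∀ᶠ ρ : ℝ in atTop, (f + ε / 2 + C) * M' / (ε / 2) ≤ Real.log ρ :=
    Real.tendsto_log_atTop.eventually_ge_atTop _
  obtain ⟨ρ₀, hρ₀⟩ := eventually_atTop.1 ((hN.eventually
    ((eventually_fCount_lt (show f < f + ε / 2 by linarith)).and (eventually_gt_atTop n₀))).and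
    (hlarge.and (eventually_ge_atTop (1 : ℝ))))
  refine ⟨ρ₀, fun ρ hρ => ?_⟩
  obtain ⟨⟨h1, h2⟩, h3, h4⟩ := hρ₀ ρ hρ
  have hlog : 0 ≤ Real.log ρ := Real.log_nonneg h4
  have h5 := hC (⌊Real.log ρ / M'⌋₊ + 1) ρ fun m hm => by
    rcases lt_or_ge m n₀ with h6 | h6
    · exact h6.trans h2
    · rw [Nat.lt_succ_iff]
      apply Nat.le_floor
      rw [le_div_iff₀ hM'0, mul_comm]
      refine (hn₀ m h6).trans ?_
      -- A zero denominator, as at index `0`, is harmless by the convention `Real.log 0 = 0`.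
      rcases (abs_nonneg (den ξ m : ℝ)).eq_or_lt with h7 | h7
      · rw [← h7, Real.log_zero]; exact hlog
      · exact Real.log_le_log h7 hm
  have h6 : (⌊Real.log ρ / M'⌋₊ : ℝ) ≤ Real.log ρ / M' := Nat.floor_le (by positivity)
  push_cast at h1
  have h7 : (1 + ε) * ((f + ε) / M) * Real.log ρ = (f + ε) * (Real.log ρ / M') := by
    rw [hM']; field_simp
  have h8 : f + ε / 2 + C ≤ ε / 2 * (Real.log ρ / M') := by
    rw [div_le_iff₀ (by positivity)] at h3
    rw [← mul_div_assoc, le_div_iff₀ hM'0]; linarith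
  rw [h7]
  have h9 : (f + ε / 2) * ⌊Real.log ρ / M'⌋₊ ≤ (f + ε / 2) * (Real.log ρ / M') :=
    mul_le_mul_of_nonneg_left h6 (by linarith)
  linarith

end

end HurwitzForm

theorem corollary5p1 (a b c d : ℝ) (hdet : a * d - b * c = 1) (hb : b ≠ 0)
    (hirr : Irrational (a / b)) (δ κ ε : ℝ) (hδ0 : 0 < δ) (hδ : δ < √(2 / Real.pi))
    (hκ : 0 < κ) (hε : 0 < ε) :
    (HurwitzForm.alphaPlus (a / b) < ⊤ →
      ∃ ρ₀ : ℝ, ∀ ρ : ℝ, ρ₀ ≤ ρ →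
        (1 - ε) * (HurwitzForm.eMinus (a / b) δ /
            ((HurwitzForm.alphaPlus (a / b)).toReal + HurwitzForm.c0)) * Real.log ρ ≤
          ((HurwitzForm.G a b c d δ κ ρ).ncard : ℝ)) ∧
    (∀ M : ℝ, 0 < M → (M : EReal) ≤ HurwitzForm.omega (a / b) →
      ∃ ρ₀ : ℝ, ∀ ρ : ℝ, ρ₀ ≤ ρ →
        ((HurwitzForm.G a b c d δ κ ρ).ncard : ℝ) ≤
          (1 + ε) * ((HurwitzForm.fPlus (a / b) δ + ε) / M) * Real.log ρ) ∧
    (∀ M : ℝ, 0 < M → (M : EReal) ≤ (HurwitzForm.eta : EReal) * HurwitzForm.alphaMinus (a / b) →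
      ∃ ρ₀ : ℝ, ∀ ρ : ℝ, ρ₀ ≤ ρ →
        ((HurwitzForm.G a b c d δ κ ρ).ncard : ℝ) ≤
          (1 + ε) * ((HurwitzForm.fPlus (a / b) δ + ε) / M) * Real.log ρ) := by
  -- The range of `δ` gives `δ ^ 2 / 2 < 1 / π < 1 / 3`, below the Legendre constant `lam > 0.38`.
  have hδ' : δ ^ 2 / 2 < 0.38 := by
    have h1 := (Real.lt_sqrt hδ0.le).1 hδ
    have h2 : 2 / Real.pi < 2 / 3 := by
      apply div_lt_div_of_pos_left (by norm_num) (by norm_num) Real.pi_gt_three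
    norm_num; linarith
  refine ⟨fun hα => HurwitzForm.ncard_G_ge hdet hb hirr hδ0 hε hα, fun M hM hω => ?_,
    fun M hM hη => ?_⟩
  · exact HurwitzForm.ncard_G_le hdet hb hirr hδ0 hδ' hκ hε hM fun M' hM' =>
      HurwitzForm.eventually_le_log_den (HurwitzForm.omegaSum_le hirr)
        (fun r hr => HurwitzForm.eventually_lt_of_le_liminf hω hr) hM'
  · exact HurwitzForm.ncard_G_le hdet hb hirr hδ0 hδ' hκ hε hM fun M' hM' =>
      HurwitzForm.eventually_le_log_den
        (g := fun n => HurwitzForm.eta * HurwitzForm.alphaSum (a / b) n)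
        (HurwitzForm.eta_mul_alphaSum_le hirr)
        (fun r hr => HurwitzForm.eventually_lt_eta_mul_alphaSum hη hr) hM'
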